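/- Let $\Theta$ be a Polish metric space with its Borel $\sigma$-algebra; call a measure on $\Theta$ locally finite if it is finite on sets of bounded diameter. Let $H$ be a locally finite measure on $\Theta$, let $\beta_t>0$, $c_t>0$ for $t\ge 2$, and let $(W_t)_{t\ge 1}$ be an M-ARG(1) process with these parameters, that is, a Markov process (with respect to its own past) of random locally finite measures on $\Theta$ such that for every $t\ge 1$ the conditional law of $W_{t+1}$ given $W_t$ is the noncentral gamma process $\mathrm{NcGaP}(H,\beta_{t+1}W_t,c_{t+1}^{-1})$: for every nonnegative bounded measurable $f$ with bounded support, almost surely $$E\big(e^{-\int f\,dW_{t+1}}\mid W_t\big)=\exp\Big(-\int_\Theta\log(1+c_{t+1}f)\,dH-\int_\Theta\frac{\beta_{t+1}c_{t+1}f}{1+c_{t+1}f}\,dW_t\Big).$$ The initial value $W_1$ is an arbitrary, possibly random, locally finite measure. Put $\rho_j=\beta_jc_j$ and, for $t\ge 1$, $h\ge 0$, $$\rho_{t+h|t}=\prod_{j=t+1}^{t+h}\rho_j,\qquad c_{t+h|t}=\sum_{j=t+1}^{t+h}c_j\prod_{i=j+1}^{t+h}\rho_i$$ (so $\rho_{t|t}=1$,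 $c_{t|t}=0$). Let $\bar W_1(A)=E(W_1(A))$ be the mean measure of $W_1$, and write $W_t(g)=\int_\Theta g\,dW_t$. Let $t\ge 1$ and $h\ge 0$. (1) For every measurable $g:\Theta\to[0,\infty]$, as an identity in $[0,\infty]$, and for every measurable $g:\Theta\to\mathbb R$ that is integrable with respect to $H$ and $\bar W_1$, $$E(W_t(g))=c_{t|1}\int_\Theta g\,dH+\rho_{t|1}\int_\Theta g\,d\bar W_1;$$ in the second case $g$ is almost surely $W_t$-integrable and $W_t(g)$ is integrable. Now let $g_1,g_2:\Theta\to\mathbb R$ be measurable and integrable with respect to $H$ and $\bar W_1$. (2) If $g_1g_2$ is integrable with respect to $H$ and $\bar W_1$, and $E\big(W_1(|g_1|)\,W_1(|g_2|)\big)<\infty$, then $W_t(g_1)W_{t+h}(g_2)$ is integrable; in particular (take $h=0$) all the covariances in (3) and (4) exist, and both formulas hold. (3) If $g_1g_2$ is integrable with respect to $H$ and $\bar W_1$, and $W_1(g_1)W_1(g_2)$ and $W_t(g_1)W_t(g_2)$ are integrable, then $$\mathrm{cov}(W_t(g_1),W_t(g_2))=c_{t|1}^2\int_\Theta g_1g_2\,dH+2\rho_{t|1}c_{t|1}\int_\Theta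 g_1g_2\,d\bar W_1+\rho_{t|1}^2\,\mathrm{cov}(W_1(g_1),W_1(g_2)).$$ (4) If $W_t(g_1)W_t(g_2)$ and $W_t(g_1)W_{t+h}(g_2)$ are integrable, then $$\mathrm{cov}(W_t(g_1),W_{t+h}(g_2))=\rho_{t+h|t}\,\mathrm{cov}(W_t(g_1),W_t(g_2)).$$ -/

import Mathlib

open MeasureTheory ProbabilityTheory Filter

namespace MARG

/-- A measure on a metric space is locally finite if every measurable set of bounded diameter has
finite measure. -/
def BoundedlyFinite {Θ : Type*} [MetricSpace Θ] [MeasurableSpace Θ] (μ : Measure Θ) : Prop :=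
  ∀ B : Set Θ, MeasurableSet B → Bornology.IsBounded B → μ B < ⊤

/-- The class `BM₊(Θ)`: measurable, nonnegative, bounded functions with bounded support. -/
def IsBMPlus {Θ : Type*} [MetricSpace Θ] [MeasurableSpace Θ] (f : Θ → ℝ) : Prop :=
  Measurable f ∧ (∀ θ, 0 ≤ f θ) ∧ (∃ C : ℝ, ∀ θ, f θ ≤ C) ∧
    Bornology.IsBounded (Function.support f)

/-- The Laplace functional of the noncentral gamma process `NcGaP(H, M, c⁻¹)`. -/
noncomputable def ncGammaLaplace {Θ : Type*} [MeasurableSpace Θ]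
    (H M : Measure Θ) (c : ℝ) (f : Θ → ℝ) : ℝ :=
  Real.exp (-(∫ θ, Real.log (1 + c * f θ) ∂H) - ∫ θ, c * f θ / (1 + c * f θ) ∂M)

/-- Conditionally on the sub-σ-algebra `m`, the random measure `X` is a noncentral gamma process
`NcGaP(H, M, c⁻¹)` (`M` may be random), in terms of its conditional Laplace functional. -/
def CondNcGamma {Ω Θ : Type*} [MeasurableSpace Ω] [MetricSpace Θ] [MeasurableSpace Θ]
    (P : Measure Ω) (m : MeasurableSpace Ω) (X : Ω → Measure Θ)
    (H : Measure Θ) (M : Ω → Measure Θ) (c : ℝ) : Prop :=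
  ∀ f : Θ → ℝ, IsBMPlus f →
    P[fun ω => Real.exp (-∫ θ, f θ ∂(X ω)) | m] =ᵐ[P] fun ω => ncGammaLaplace H (M ω) c f

/-- The σ-algebra generated by `W₁, …, W_t`. -/
def past {Ω Θ : Type*} [MeasurableSpace Θ] (W : ℕ → Ω → Measure Θ) (t : ℕ) : MeasurableSpace Ω :=
  ⨆ s ∈ Set.Icc 1 t, MeasurableSpace.comap (W s) inferInstance

/-- `(W_t)_{t ≥ 1}` is a measure-valued autoregressive gamma process M-ARG(1) on `Θ` with base
measure `H` and parameters `(β_t, c_t)_{t ≥ 2}`, on the probability space `(Ω, P)`. The values at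
index `0` of `W` and at indices `0, 1` of `β` and `c` play no role. -/
structure IsMARG {Ω Θ : Type*} [MeasurableSpace Ω] [MetricSpace Θ] [MeasurableSpace Θ]
    (P : Measure Ω) (H : Measure Θ) (β c : ℕ → ℝ) (W : ℕ → Ω → Measure Θ) : Prop where
  base_finite : BoundedlyFinite H
  β_pos : ∀ t, 2 ≤ t → 0 < β t
  c_pos : ∀ t, 2 ≤ t → 0 < c t
  measurable : ∀ t, 1 ≤ t → Measurable (W t)
  finite : ∀ t, 1 ≤ t → ∀ ω, BoundedlyFinite (W t ω)
  /-- Markov property. -/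
  markov : ∀ t, 1 ≤ t → ∀ φ : Measure Θ → ℝ, Measurable φ → (∃ C : ℝ, ∀ ν, |φ ν| ≤ C) →
    P[fun ω => φ (W (t + 1) ω) | past W t] =ᵐ[P]
      P[fun ω => φ (W (t + 1) ω) | MeasurableSpace.comap (W t) inferInstance]
  /-- Transition: `W_{t+1} | W_t ∼ NcGaP(H, β_{t+1} W_t, c_{t+1}⁻¹)`. -/
  transition : ∀ t, 1 ≤ t →
    CondNcGamma P (MeasurableSpace.comap (W t) inferInstance) (W (t + 1)) H
      (fun ω => ENNReal.ofReal (β (t + 1)) • W t ω) (c (t + 1))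

/-- `ρ_{s|t} = ∏_{j=t+1}^{s} β_j c_j`; in particular `ρ_{t|t} = 1`. -/
noncomputable def lagRho (β c : ℕ → ℝ) (s t : ℕ) : ℝ :=
  ∏ j ∈ Finset.Icc (t + 1) s, β j * c j

/-- `c_{s|t} = ∑_{j=t+1}^{s} c_j ∏_{i=j+1}^{s} β_i c_i`; in particular `c_{t|t} = 0`. -/
noncomputable def lagScale (β c : ℕ → ℝ) (s t : ℕ) : ℝ :=
  ∑ j ∈ Finset.Icc (t + 1) s, c j * ∏ i ∈ Finset.Icc (j + 1) s, β i * c i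

theorem lagRho_self (β c : ℕ → ℝ) (t : ℕ) : lagRho β c t t = 1 := by
  simp [lagRho]

theorem lagScale_self (β c : ℕ → ℝ) (t : ℕ) : lagScale β c t t = 0 := by
  simp [lagScale]

/-- For `h ≥ 1`, `c_{t+h|t} = c_{t+h} + ∑_{j=t+1}^{t+h-1} c_j ∏_{i=j+1}^{t+h} β_i c_i`. -/
theorem lagScale_add (β c : ℕ → ℝ) (t h : ℕ) (hh : 1 ≤ h) :
    lagScale β c (t + h) t = c (t + h) +
      ∑ j ∈ Finset.Icc (t + 1) (t + h - 1), c j * ∏ i ∈ Finset.Icc (j + 1) (t + h), β i * c i := by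
  obtain ⟨k, rfl⟩ : ∃ k, h = k + 1 := ⟨h - 1, by omega⟩
  have e : t + (k + 1) - 1 = t + k := by omega
  rw [lagScale, e, ← add_assoc, Finset.sum_Icc_succ_top (by omega), add_comm]
  simp

/-- The mean measure `A ↦ E(X(A))` of a random measure `X`. -/
noncomputable def meanMeasure {Ω Θ : Type*} [MeasurableSpace Ω] [MeasurableSpace Θ]
    (P : Measure Ω) (X : Ω → Measure Θ) : Measure Θ :=
  P.bind X

theorem meanMeasure_apply {Ω Θ : Type*} [MeasurableSpace Ω] [MeasurableSpace Θ]
    (P : Measure Ω) (X : Ω → Measure Θ) (hX : Measurable X) (A : Set Θ) (hA : MeasurableSet A) :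
    meanMeasure P X A = ∫⁻ ω, X ω A ∂P :=
  Measure.bind_apply hA hX.aemeasurable

/-- The integral functional `X(g) = ∫ g dX` of a random measure, as a real random variable. -/
noncomputable def integ {Ω Θ : Type*} [MeasurableSpace Θ]
    (X : Ω → Measure Θ) (g : Θ → ℝ) : Ω → ℝ :=
  fun ω => ∫ θ, g θ ∂(X ω)

end MARG

namespace MARG

open scoped Topology

/-! ### Elementary bounds, and limits of integrals without a dominating function -/

section Limits

/-! The first two conditional moments come from differentiating the conditional Laplace functional
at zero. Write `ψ` for its exponent, so that E(exp(-W_{t+1}(f)) | past) = exp(-ψ(f)), and let λ → 0.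
The quotient (1 - exp(-λX)) / λ yields the conditional mean c ∫ f dH + ρ W_t(f). The mixed second
difference of exp(-·) yields the conditional mean of W_{t+1}(f) W_{t+1}(g): the product of the two
conditional means, plus the limit of (ψ(λf) + ψ(λg) - ψ(λf + λg)) / λ², which is c² ∫ fg dH + 2cρ
W_t(fg).

For general nonnegative functions no moment of W_1 need be finite, so domination over Ω is not
available. Instead, the difference quotients never exceed their limits, and Fatou's lemma then gives
convergence of their integrals in [0, ∞] (`lintegral_eq_of_tendsto_of_le`). The moment identities
therefore hold even when both sides are infinite. Monotone convergence extends them to all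
measurable functions with values in [0, ∞], and they hold against every weight `Z` measurable with
respect to the past (`IsMARG.lintegral_mul_succ`, `IsMARG.lintegral_mul_mul_succ`).

The one-step conditional mean is affine in W_t, and composing these affine maps produces `lagScale`
and `lagRho`. The second-moment formula keeps its shape under composition, with (c, ρ) replaced by
the accumulated pair (`lintegral_second_moment_step`).

Signed functions are split into positive and negative parts. The lag-zero covariance assumes only
that the signed products are integrable, so the second-moment identity is proved on events of σ(W_1)
on which the W_1(|g_i|) are bounded, and these events exhaust Ω (`IsMARG.integral_integ_mul`). At
lag h, E(W_{t+h}(g₂) | past) is affine in W_t(g₂) and W_t(g₁) can be pulled out of the conditional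
expectation (`IsMARG.covariance_integ_add`). -/

theorem div_one_add_le_one_sub_exp_neg {y : ℝ} (hy : 0 ≤ y) : y / (1 + y) ≤ 1 - Real.exp (-y) := by
  have h : Real.exp (-y) ≤ 1 / (1 + y) := by
    rw [Real.exp_neg, ← one_div]
    exact one_div_le_one_div_of_le (by linarith) (by linarith [Real.add_one_le_exp y])
  have : y / (1 + y) = 1 - 1 / (1 + y) := by field_simp; ring
  linarith

theorem one_sub_exp_neg_le (y : ℝ) : 1 - Real.exp (-y) ≤ y := by
  linarith [Real.add_one_le_exp (-y)]

theorem div_one_add_le_log {y : ℝ} (hy : 0 ≤ y) : y / (1 + y) ≤ Real.log (1 + y) := by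
  have h := Real.one_sub_inv_le_log_of_pos (x := 1 + y) (by linarith)
  have : y / (1 + y) = 1 - (1 + y)⁻¹ := by field_simp; ring
  linarith

theorem log_one_add_le {y : ℝ} (hy : 0 ≤ y) : Real.log (1 + y) ≤ y := by
  linarith [Real.log_le_sub_one_of_pos (x := 1 + y) (by linarith)]

/-- If `y / (1 + y) ≤ φ y ≤ y`, then `φ` has derivative one at zero, in sequential form. -/
theorem tendsto_div_of_squeeze {φ : ℝ → ℝ} (h1 : ∀ y, 0 ≤ y → y / (1 + y) ≤ φ y)
    (h2 : ∀ y, 0 ≤ y → φ y ≤ y) {l y : ℕ → ℝ} {m : ℝ} (hl : ∀ n, 0 < l n)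
    (hl0 : Tendsto l atTop (𝓝 0)) (hy : ∀ n, 0 ≤ y n)
    (hm : Tendsto (fun n => y n / l n) atTop (𝓝 m)) :
    Tendsto (fun n => φ (y n) / l n) atTop (𝓝 m) := by
  have hy0 : Tendsto y atTop (𝓝 0) := by
    have := hm.mul hl0
    rw [mul_zero] at this
    exact this.congr fun n => div_mul_cancel₀ _ (hl n).ne'
  have hlow : Tendsto (fun n => y n / l n / (1 + y n)) atTop (𝓝 m) := by
    have := hm.div (hy0.const_add 1) (by norm_num)
    simp only [add_zero, div_one] at this
    exact this
  refine tendsto_of_tendsto_of_tendsto_of_le_of_le hlow hm (fun n => ?_) (fun n => ?_)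
  · have := div_le_div_of_nonneg_right (h1 _ (hy n)) (hl n).le
    rwa [div_right_comm] at this
  · exact div_le_div_of_nonneg_right (h2 _ (hy n)) (hl n).le

/-- Fatou bounds the integral of the limit by the liminf of the integrals, and `U n ≤ X` bounds the
limsup by the same integral. Nothing has to be finite. -/
theorem lintegral_eq_of_tendsto_of_le {Ω : Type*} [MeasurableSpace Ω] {μ : Measure Ω}
    {U V : ℕ → Ω → ENNReal} {X Y : Ω → ENNReal} (hU : ∀ n, Measurable (U n))
    (hV : ∀ n, Measurable (V n)) (hUX : ∀ n ω, U n ω ≤ X ω) (hVY : ∀ n ω, V n ω ≤ Y ω)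
    (hX : ∀ ω, Tendsto (fun n => U n ω) atTop (𝓝 (X ω)))
    (hY : ∀ ω, Tendsto (fun n => V n ω) atTop (𝓝 (Y ω)))
    (h : ∀ n, ∫⁻ ω, U n ω ∂μ = ∫⁻ ω, V n ω ∂μ) : ∫⁻ ω, X ω ∂μ = ∫⁻ ω, Y ω ∂μ := by
  have key : ∀ {U : ℕ → Ω → ENNReal} {X : Ω → ENNReal}, (∀ n, Measurable (U n)) →
      (∀ n ω, U n ω ≤ X ω) → (∀ ω, Tendsto (fun n => U n ω) atTop (𝓝 (X ω))) →
      Tendsto (fun n => ∫⁻ ω, U n ω ∂μ) atTop (𝓝 (∫⁻ ω, X ω ∂μ)) := by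
    intro U X hU hUX hX
    refine tendsto_of_le_liminf_of_limsup_le ?_ ?_
    · calc ∫⁻ ω, X ω ∂μ = ∫⁻ ω, liminf (fun n => U n ω) atTop ∂μ :=
            lintegral_congr fun ω => (hX ω).liminf_eq.symm
        _ ≤ _ := lintegral_liminf_le hU
    · refine limsup_le_of_le ?_ (Eventually.of_forall fun n => lintegral_mono (hUX n))
      isBoundedDefault
  refine tendsto_nhds_unique (key hU hUX hX) ?_
  simp_rw [h]
  exact key hV hVY hY

end Limits

/-! ### Measurability of integration as a function of the measure -/

section MeasurableIntegral

variable {Θ : Type*} [MeasurableSpace Θ]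

/-- Where `g` is `ν`-integrable, the Bochner integral is a difference of two Lebesgue integrals,
each measurable in `ν`. Elsewhere it takes the default value 0, and the set where this happens is
measurable. -/
theorem measurable_integral_measure {g : Θ → ℝ} (hg : Measurable g) :
    Measurable (fun ν : Measure Θ => ∫ θ, g θ ∂ν) := by
  classical
  have h : (fun ν : Measure Θ => ∫ θ, g θ ∂ν) = fun ν : Measure Θ =>
      if ∫⁻ θ, ‖g θ‖ₑ ∂ν < ⊤ then (∫⁻ θ, ENNReal.ofReal (g θ) ∂ν).toReal -
        (∫⁻ θ, ENNReal.ofReal (-g θ) ∂ν).toReal else 0 := by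
    funext ν
    split_ifs with h
    · exact integral_eq_lintegral_pos_part_sub_lintegral_neg_part ⟨hg.aestronglyMeasurable, h⟩
    · exact integral_undef fun h' => h h'.2
  rw [h]
  refine Measurable.ite (measurableSet_lt (Measure.measurable_lintegral hg.enorm)
    measurable_const) ?_ measurable_const
  exact (Measure.measurable_lintegral hg.ennreal_ofReal).ennreal_toReal.sub
    (Measure.measurable_lintegral hg.neg.ennreal_ofReal).ennreal_toReal

end MeasurableIntegral

/-! ### Expansion of the Laplace exponent to second order at zero -/

section Exponent

variable {Θ : Type*} [MeasurableSpace Θ]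

/-- The Laplace exponent of the noncentral gamma process. -/
noncomputable def ncGammaExponent (H M : Measure Θ) (c : ℝ) (f : Θ → ℝ) : ℝ :=
  ∫ θ, Real.log (1 + c * f θ) ∂H + ∫ θ, c * f θ / (1 + c * f θ) ∂M

theorem ncGammaLaplace_eq (H M : Measure Θ) (c : ℝ) (f : Θ → ℝ) :
    ncGammaLaplace H M c f = Real.exp (-ncGammaExponent H M c f) := by
  rw [ncGammaLaplace, ncGammaExponent]; congr 1; ring

theorem ncGammaExponent_nonneg (H M : Measure Θ) {c : ℝ} (hc : 0 < c) {f : Θ → ℝ}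
    (hf : ∀ θ, 0 ≤ f θ) : 0 ≤ ncGammaExponent H M c f := by
  refine add_nonneg (integral_nonneg fun θ => Real.log_nonneg ?_) (integral_nonneg fun θ => ?_)
  · have := mul_nonneg hc.le (hf θ); linarith
  · have := mul_nonneg hc.le (hf θ); simp only [Pi.zero_apply]; positivity

theorem integrable_log_one_add {H : Measure Θ} {c : ℝ} (hc : 0 < c) {f : Θ → ℝ}
    (hfm : Measurable f) (hf : ∀ θ, 0 ≤ f θ) (hH : Integrable f H) :
    Integrable (fun θ => Real.log (1 + c * f θ)) H := by
  refine (hH.const_mul c).mono' (Measurable.aestronglyMeasurable (by fun_prop)) (ae_of_all _ fun θ => ?_)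
  have h0 := mul_nonneg hc.le (hf θ)
  rw [Real.norm_of_nonneg (Real.log_nonneg (by linarith))]
  exact log_one_add_le h0

theorem integrable_div_one_add {M : Measure Θ} {c : ℝ} (hc : 0 < c) {f : Θ → ℝ}
    (hfm : Measurable f) (hf : ∀ θ, 0 ≤ f θ) (hM : Integrable f M) :
    Integrable (fun θ => c * f θ / (1 + c * f θ)) M := by
  refine (hM.const_mul c).mono' (Measurable.aestronglyMeasurable (by fun_prop)) (ae_of_all _ fun θ => ?_)
  have h0 := mul_nonneg hc.le (hf θ)
  rw [Real.norm_of_nonneg (by positivity)]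
  exact div_le_self h0 (by linarith)

theorem ncGammaExponent_le {H M : Measure Θ} {c : ℝ} (hc : 0 < c) {f : Θ → ℝ}
    (hfm : Measurable f) (hf : ∀ θ, 0 ≤ f θ) (hH : Integrable f H) (hM : Integrable f M) :
    ncGammaExponent H M c f ≤ c * ∫ θ, f θ ∂H + c * ∫ θ, f θ ∂M := by
  rw [← integral_const_mul, ← integral_const_mul]
  refine add_le_add (integral_mono (integrable_log_one_add hc hfm hf hH) (hH.const_mul c)
    fun θ => log_one_add_le (mul_nonneg hc.le (hf θ)))
    (integral_mono (integrable_div_one_add hc hfm hf hM) (hM.const_mul c) fun θ => ?_)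
  have h0 := mul_nonneg hc.le (hf θ)
  exact div_le_self h0 (by linarith)

/-- Both log(1 + y) and y / (1 + y) lie between y / (1 + y) and y, so each integrand has derivative
`c * f` at zero and is dominated by it. -/
theorem tendsto_ncGammaExponent_div {H M : Measure Θ} {c : ℝ} (hc : 0 < c) {f : Θ → ℝ}
    (hfm : Measurable f) (hf : ∀ θ, 0 ≤ f θ) (hH : Integrable f H) (hM : Integrable f M)
    {l : ℕ → ℝ} (hl : ∀ n, 0 < l n) (hl0 : Tendsto l atTop (𝓝 0)) :
    Tendsto (fun n => ncGammaExponent H M c (fun θ => l n * f θ) / l n) atTop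
      (𝓝 (c * ∫ θ, f θ ∂H + c * ∫ θ, f θ ∂M)) := by
  have hpt : ∀ θ, Tendsto (fun n => c * (l n * f θ) / l n) atTop (𝓝 (c * f θ)) := fun θ =>
    tendsto_const_nhds.congr fun n => by have := (hl n).ne'; field_simp
  have hnn : ∀ θ n, 0 ≤ c * (l n * f θ) := fun θ n =>
    mul_nonneg hc.le (mul_nonneg (hl n).le (hf θ))
  have hup : ∀ θ n, c * (l n * f θ) / l n = c * f θ := fun θ n => by
    have := (hl n).ne'; field_simp
  simp_rw [ncGammaExponent, add_div, ← integral_div, ← integral_const_mul]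
  refine Tendsto.add ?_ ?_
  · refine tendsto_integral_of_dominated_convergence (fun θ => c * f θ) (fun n => Measurable.aestronglyMeasurable (by fun_prop))
      (hH.const_mul c) (fun n => ae_of_all _ fun θ => ?_) (ae_of_all _ fun θ => ?_)
    · rw [Real.norm_of_nonneg (div_nonneg (Real.log_nonneg (by linarith [hnn θ n])) (hl n).le),
        ← hup θ n]
      exact div_le_div_of_nonneg_right (log_one_add_le (hnn θ n)) (hl n).le
    · exact tendsto_div_of_squeeze (φ := fun y => Real.log (1 + y))
        (fun _ => div_one_add_le_log) (fun _ => log_one_add_le) hl hl0 (hnn θ) (hpt θ)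
  · refine tendsto_integral_of_dominated_convergence (fun θ => c * f θ)
      (fun n => Measurable.aestronglyMeasurable (by fun_prop)) (hM.const_mul c) (fun n => ae_of_all _ fun θ => ?_)
      (ae_of_all _ fun θ => ?_)
    · have := hnn θ n
      rw [Real.norm_of_nonneg (div_nonneg (by positivity) (hl n).le), ← hup θ n]
      exact div_le_div_of_nonneg_right (div_le_self this (by linarith)) (hl n).le
    · exact tendsto_div_of_squeeze (φ := fun y => y / (1 + y)) (fun _ _ => le_rfl)
        (fun _ h => div_le_self h (by linarith)) hl hl0 (hnn θ) (hpt θ)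

/-- Rests on (1 + a)(1 + b) = (1 + a + b) + ab. -/
theorem log_defect {a b : ℝ} (ha : 0 ≤ a) (hb : 0 ≤ b) :
    Real.log (1 + a) + Real.log (1 + b) - Real.log (1 + (a + b)) =
      Real.log (1 + a * b / (1 + (a + b))) := by
  rw [← Real.log_mul (by positivity) (by positivity), ← Real.log_div (by positivity)
    (by positivity)]
  congr 1; field_simp; ring

/-- Split (a + b) / (1 + a + b) and pair each piece with its own term: a / (1 + a) - a / (1 + a + b)
is the first summand on the right. -/
theorem div_defect {a b : ℝ} (ha : 0 ≤ a) (hb : 0 ≤ b) :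
    a / (1 + a) + b / (1 + b) - (a + b) / (1 + (a + b)) =
      a * b / ((1 + a) * (1 + (a + b))) + a * b / ((1 + b) * (1 + (a + b))) := by
  field_simp; ring

/-- The subadditivity defect of the Laplace exponent. -/
theorem ncGammaExponent_defect {H M : Measure Θ} {c : ℝ} (hc : 0 < c) {f g : Θ → ℝ}
    (hfm : Measurable f) (hf : ∀ θ, 0 ≤ f θ) (hfH : Integrable f H) (hfM : Integrable f M)
    (hgm : Measurable g) (hg : ∀ θ, 0 ≤ g θ) (hgH : Integrable g H) (hgM : Integrable g M) :
    ncGammaExponent H M c f + ncGammaExponent H M c g -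
        ncGammaExponent H M c (fun θ => f θ + g θ) =
      ∫ θ, Real.log (1 + c * f θ * (c * g θ) / (1 + (c * f θ + c * g θ))) ∂H +
      ∫ θ, (c * f θ * (c * g θ) / ((1 + c * f θ) * (1 + (c * f θ + c * g θ))) +
        c * f θ * (c * g θ) / ((1 + c * g θ) * (1 + (c * f θ + c * g θ)))) ∂M := by
  have h1 : ∀ θ, Real.log (1 + c * f θ * (c * g θ) / (1 + (c * f θ + c * g θ))) =
      Real.log (1 + c * f θ) + Real.log (1 + c * g θ) - Real.log (1 + c * (f θ + g θ)) := by
    intro θ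
    rw [mul_add c, ← log_defect (mul_nonneg hc.le (hf θ)) (mul_nonneg hc.le (hg θ))]
  have h2 : ∀ θ, c * f θ * (c * g θ) / ((1 + c * f θ) * (1 + (c * f θ + c * g θ))) +
        c * f θ * (c * g θ) / ((1 + c * g θ) * (1 + (c * f θ + c * g θ))) =
      c * f θ / (1 + c * f θ) + c * g θ / (1 + c * g θ) -
        c * (f θ + g θ) / (1 + c * (f θ + g θ)) := by
    intro θ
    rw [mul_add c, ← div_defect (mul_nonneg hc.le (hf θ)) (mul_nonneg hc.le (hg θ))]
  have hfg : ∀ θ, 0 ≤ f θ + g θ := fun θ => add_nonneg (hf θ) (hg θ)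
  simp_rw [h1, h2]
  have i1 := integrable_log_one_add hc hfm hf hfH
  have i2 := integrable_log_one_add hc hgm hg hgH
  have i3 : Integrable (fun θ => Real.log (1 + c * (f θ + g θ))) H :=
    integrable_log_one_add hc (hfm.add hgm) hfg (hfH.add hgH)
  have j1 := integrable_div_one_add hc hfm hf hfM
  have j2 := integrable_div_one_add hc hgm hg hgM
  have j3 : Integrable (fun θ => c * (f θ + g θ) / (1 + c * (f θ + g θ))) M :=
    integrable_div_one_add hc (hfm.add hgm) hfg (hfM.add hgM)
  rw [integral_sub (i1.fun_add i2) i3, integral_add i1 i2, integral_sub (j1.fun_add j2) j3,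
    integral_add j1 j2]
  simp only [ncGammaExponent]
  ring

/-- The defect is of order λ². The logarithm contributes one term (cf)(cg) under `H`, the fraction
two such terms under `M`; this is the origin of the factor 2 in the covariance. Sign, bound and
limit are the three inputs that `second_difference_bounds` needs. -/
theorem tendsto_ncGammaExponent_defect_div {H M : Measure Θ} {c : ℝ} (hc : 0 < c) {f g : Θ → ℝ}
    (hfm : Measurable f) (hf : ∀ θ, 0 ≤ f θ) (hfH : Integrable f H) (hfM : Integrable f M)
    (hgm : Measurable g) (hg : ∀ θ, 0 ≤ g θ) (hgH : Integrable g H) (hgM : Integrable g M)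
    (hfgH : Integrable (fun θ => f θ * g θ) H) (hfgM : Integrable (fun θ => f θ * g θ) M)
    {l : ℕ → ℝ} (hl : ∀ n, 0 < l n) (hl0 : Tendsto l atTop (𝓝 0)) :
    (∀ n, 0 ≤ ncGammaExponent H M c (fun θ => l n * f θ) +
        ncGammaExponent H M c (fun θ => l n * g θ) -
        ncGammaExponent H M c (fun θ => l n * f θ + l n * g θ)) ∧
    (∀ n, (ncGammaExponent H M c (fun θ => l n * f θ) +
        ncGammaExponent H M c (fun θ => l n * g θ) -
        ncGammaExponent H M c (fun θ => l n * f θ + l n * g θ)) / l n ^ 2 ≤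
      c ^ 2 * ∫ θ, f θ * g θ ∂H + 2 * c ^ 2 * ∫ θ, f θ * g θ ∂M) ∧
    Tendsto (fun n => (ncGammaExponent H M c (fun θ => l n * f θ) +
        ncGammaExponent H M c (fun θ => l n * g θ) -
        ncGammaExponent H M c (fun θ => l n * f θ + l n * g θ)) / l n ^ 2) atTop
      (𝓝 (c ^ 2 * ∫ θ, f θ * g θ ∂H + 2 * c ^ 2 * ∫ θ, f θ * g θ ∂M)) := by
  have hD : ∀ n, _ := fun n => ncGammaExponent_defect (H := H) (M := M) (c := c) hc
    (f := fun θ => l n * f θ) (g := fun θ => l n * g θ) (hfm.const_mul _)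
    (fun θ => mul_nonneg (hl n).le (hf θ)) (hfH.const_mul _) (hfM.const_mul _) (hgm.const_mul _)
    (fun θ => mul_nonneg (hl n).le (hg θ)) (hgH.const_mul _) (hgM.const_mul _)
  have ha : ∀ θ n, 0 ≤ c * (l n * f θ) := fun θ n =>
    mul_nonneg hc.le (mul_nonneg (hl n).le (hf θ))
  have hb : ∀ θ n, 0 ≤ c * (l n * g θ) := fun θ n =>
    mul_nonneg hc.le (mul_nonneg (hl n).le (hg θ))
  have hl2 : ∀ n, 0 < l n ^ 2 := fun n => pow_pos (hl n) 2
  have hl20 : Tendsto (fun n => l n ^ 2) atTop (𝓝 0) := by simpa using hl0.pow 2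
  have hab : ∀ θ n, c * (l n * f θ) * (c * (l n * g θ)) / l n ^ 2 = c ^ 2 * (f θ * g θ) :=
    fun θ n => by have := (hl n).ne'; field_simp
  have hu : ∀ θ n, 0 ≤ c * (l n * f θ) * (c * (l n * g θ)) /
      (1 + (c * (l n * f θ) + c * (l n * g θ))) := fun θ n => by
    have := ha θ n; have := hb θ n; positivity
  have hu' : ∀ θ n, c * (l n * f θ) * (c * (l n * g θ)) /
      (1 + (c * (l n * f θ) + c * (l n * g θ))) ≤ c * (l n * f θ) * (c * (l n * g θ)) :=
    fun θ n => div_le_self (mul_nonneg (ha θ n) (hb θ n)) (by linarith [ha θ n, hb θ n])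
  have hlf : ∀ θ, Tendsto (fun n => c * (l n * f θ)) atTop (𝓝 0) := fun θ => by
    simpa using (hl0.mul_const (f θ)).const_mul c
  have hlg : ∀ θ, Tendsto (fun n => c * (l n * g θ)) atTop (𝓝 0) := fun θ => by
    simpa using (hl0.mul_const (g θ)).const_mul c
  -- bounds and limits of the two integrands
  have hLb : ∀ n θ, ‖Real.log (1 + c * (l n * f θ) * (c * (l n * g θ)) /
      (1 + (c * (l n * f θ) + c * (l n * g θ)))) / l n ^ 2‖ ≤ c ^ 2 * (f θ * g θ) := by
    intro n θ
    rw [Real.norm_of_nonneg (div_nonneg (Real.log_nonneg (by linarith [hu θ n])) (hl2 n).le),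
      ← hab θ n]
    exact div_le_div_of_nonneg_right ((log_one_add_le (hu θ n)).trans (hu' θ n)) (hl2 n).le
  have hRb : ∀ n θ, ‖(c * (l n * f θ) * (c * (l n * g θ)) / ((1 + c * (l n * f θ)) *
        (1 + (c * (l n * f θ) + c * (l n * g θ)))) +
      c * (l n * f θ) * (c * (l n * g θ)) / ((1 + c * (l n * g θ)) *
        (1 + (c * (l n * f θ) + c * (l n * g θ))))) / l n ^ 2‖ ≤ 2 * c ^ 2 * (f θ * g θ) := by
    intro n θ
    have h1 := ha θ n
    have h2 := hb θ n
    rw [Real.norm_of_nonneg (div_nonneg (by positivity) (hl2 n).le), mul_assoc 2, ← hab θ n,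
      ← mul_div_assoc]
    refine div_le_div_of_nonneg_right ?_ (hl2 n).le
    rw [two_mul]
    refine add_le_add (div_le_self (by positivity) ?_) (div_le_self (by positivity) ?_) <;>
    exact one_le_mul_of_one_le_of_one_le (by linarith) (by linarith)
  refine ⟨fun n => ?_, fun n => ?_, ?_⟩
  · rw [hD n]
    refine add_nonneg (integral_nonneg fun θ => Real.log_nonneg (by linarith [hu θ n]))
      (integral_nonneg fun θ => ?_)
    have h1 := ha θ n
    have h2 := hb θ n
    simp only [Pi.zero_apply]
    positivity
  · rw [hD n, add_div, ← integral_div, ← integral_div, ← integral_const_mul, ← integral_const_mul]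
    refine add_le_add ((le_abs_self _).trans ?_) ((le_abs_self _).trans ?_)
    · exact norm_integral_le_of_norm_le (hfgH.const_mul _) (ae_of_all _ (hLb n))
    · exact norm_integral_le_of_norm_le (hfgM.const_mul _) (ae_of_all _ (hRb n))
  · simp_rw [hD, add_div _ _ (l _ ^ 2), ← integral_div, ← integral_const_mul]
    refine Tendsto.add ?_ ?_
    · refine tendsto_integral_of_dominated_convergence (fun θ => c ^ 2 * (f θ * g θ))
        (fun n => Measurable.aestronglyMeasurable (by fun_prop)) (hfgH.const_mul _) (fun n => ae_of_all _ (hLb n))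
        (ae_of_all _ fun θ => ?_)
      -- The squeeze is used at scale `l n ^ 2`, since the argument of the logarithm exceeds 1 by a
      -- quantity quadratic in `l n`.
      refine tendsto_div_of_squeeze (φ := fun y => Real.log (1 + y))
        (fun _ => div_one_add_le_log) (fun _ => log_one_add_le) hl2 hl20 (hu θ) ?_
      have : Tendsto (fun n => c ^ 2 * (f θ * g θ) / (1 + (c * (l n * f θ) + c * (l n * g θ))))
          atTop (𝓝 (c ^ 2 * (f θ * g θ) / (1 + (0 + 0)))) :=
        tendsto_const_nhds.div (((hlf θ).add (hlg θ)).const_add 1) (by norm_num)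
      simp only [add_zero, div_one] at this
      refine this.congr fun n => ?_
      rw [← hab θ n, div_right_comm]
    · refine tendsto_integral_of_dominated_convergence (fun θ => 2 * c ^ 2 * (f θ * g θ))
        (fun n => Measurable.aestronglyMeasurable (by fun_prop)) (hfgM.const_mul _) (fun n => ae_of_all _ (hRb n))
        (ae_of_all _ fun θ => ?_)
      have h3 : Tendsto (fun n => c ^ 2 * (f θ * g θ) / ((1 + c * (l n * f θ)) *
          (1 + (c * (l n * f θ) + c * (l n * g θ)))) + c ^ 2 * (f θ * g θ) /
          ((1 + c * (l n * g θ)) * (1 + (c * (l n * f θ) + c * (l n * g θ))))) atTop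
          (𝓝 (c ^ 2 * (f θ * g θ) / ((1 + 0) * (1 + (0 + 0))) +
            c ^ 2 * (f θ * g θ) / ((1 + 0) * (1 + (0 + 0))))) :=
        (tendsto_const_nhds.div (((hlf θ).const_add 1).mul
          (((hlf θ).add (hlg θ)).const_add 1)) (by norm_num)).add
        (tendsto_const_nhds.div (((hlg θ).const_add 1).mul
          (((hlf θ).add (hlg θ)).const_add 1)) (by norm_num))
      have e : c ^ 2 * (f θ * g θ) / ((1 + 0) * (1 + (0 + 0))) +
            c ^ 2 * (f θ * g θ) / ((1 + 0) * (1 + (0 + 0))) = 2 * c ^ 2 * (f θ * g θ) := by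
        ring
      rw [e] at h3
      refine h3.congr fun n => ?_
      rw [← hab θ n, add_div]
      congr 1 <;> rw [div_right_comm]

/-- Scaled second differences of `exp ∘ (-·)`: bound and limit. -/
theorem second_difference_bounds {l y z w : ℕ → ℝ} {a b q : ℝ} (hl : ∀ n, 0 < l n)
    (hl0 : Tendsto l atTop (𝓝 0)) (hy : ∀ n, 0 ≤ y n) (hz : ∀ n, 0 ≤ z n) (hw : ∀ n, 0 ≤ w n)
    (hya : ∀ n, y n / l n ≤ a) (hzb : ∀ n, z n / l n ≤ b)
    (hd : ∀ n, 0 ≤ y n + z n - w n) (hdq : ∀ n, (y n + z n - w n) / l n ^ 2 ≤ q)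
    (hyt : Tendsto (fun n => y n / l n) atTop (𝓝 a))
    (hzt : Tendsto (fun n => z n / l n) atTop (𝓝 b))
    (hdt : Tendsto (fun n => (y n + z n - w n) / l n ^ 2) atTop (𝓝 q)) :
    (∀ n, 0 ≤ (1 - Real.exp (-y n) - Real.exp (-z n) + Real.exp (-w n)) / l n ^ 2) ∧
    (∀ n, (1 - Real.exp (-y n) - Real.exp (-z n) + Real.exp (-w n)) / l n ^ 2 ≤ a * b + q) ∧
    Tendsto (fun n => (1 - Real.exp (-y n) - Real.exp (-z n) + Real.exp (-w n)) / l n ^ 2) atTop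
      (𝓝 (a * b + q)) := by
  -- The second difference is (1 - e^{-y})(1 - e^{-z}) plus e^{-w} - e^{-(y+z)}. With d = y + z - w,
  -- the latter equals both e^{-(y+z)}(e^d - 1) and e^{-w}(1 - e^{-d}), hence lies between
  -- e^{-(y+z)} d and d.
  have key : ∀ n, (1 - Real.exp (-y n) - Real.exp (-z n) + Real.exp (-w n)) / l n ^ 2 =
      (1 - Real.exp (-y n)) / l n * ((1 - Real.exp (-z n)) / l n) +
        (Real.exp (-w n) - Real.exp (-(y n + z n))) / l n ^ 2 := by
    intro n
    have := (hl n).ne'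
    rw [neg_add, Real.exp_add]
    field_simp
    ring
  have h1 : ∀ x : ℝ, 0 ≤ x → 0 ≤ 1 - Real.exp (-x) := fun x hx => by
    have := Real.exp_le_one_iff.2 (neg_nonpos.2 hx); linarith
  have hlow : ∀ n, Real.exp (-(y n + z n)) * ((y n + z n - w n) / l n ^ 2) ≤
      (Real.exp (-w n) - Real.exp (-(y n + z n))) / l n ^ 2 := by
    intro n
    rw [← mul_div_assoc]
    refine div_le_div_of_nonneg_right ?_ (pow_pos (hl n) 2).le
    have e : Real.exp (-w n) = Real.exp (-(y n + z n)) * Real.exp (y n + z n - w n) := by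
      rw [← Real.exp_add]; congr 1; ring
    rw [e]
    nlinarith [Real.exp_pos (-(y n + z n)), Real.add_one_le_exp (y n + z n - w n)]
  have hupp : ∀ n, (Real.exp (-w n) - Real.exp (-(y n + z n))) / l n ^ 2 ≤
      (y n + z n - w n) / l n ^ 2 := by
    intro n
    refine div_le_div_of_nonneg_right ?_ (pow_pos (hl n) 2).le
    have e : Real.exp (-(y n + z n)) = Real.exp (-w n) * Real.exp (-(y n + z n - w n)) := by
      rw [← Real.exp_add]; congr 1; ring
    rw [e]
    have h2 := one_sub_exp_neg_le (y n + z n - w n)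
    have h3 := h1 _ (hd n)
    have h4 := Real.exp_le_one_iff.2 (neg_nonpos.2 (hw n))
    nlinarith [Real.exp_pos (-w n)]
  have hsum : Tendsto (fun n => Real.exp (-(y n + z n))) atTop (𝓝 1) := by
    have hy0 : Tendsto y atTop (𝓝 0) := by
      have := hyt.mul hl0
      rw [mul_zero] at this
      exact this.congr fun n => div_mul_cancel₀ _ (hl n).ne'
    have hz0 : Tendsto z atTop (𝓝 0) := by
      have := hzt.mul hl0
      rw [mul_zero] at this
      exact this.congr fun n => div_mul_cancel₀ _ (hl n).ne'
    have := (hy0.add hz0).neg.rexp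
    simpa using this
  refine ⟨fun n => ?_, fun n => ?_, ?_⟩
  · rw [key]
    refine add_nonneg (mul_nonneg (div_nonneg (h1 _ (hy n)) (hl n).le)
      (div_nonneg (h1 _ (hz n)) (hl n).le)) (le_trans ?_ (hlow n))
    exact mul_nonneg (Real.exp_pos _).le (div_nonneg (hd n) (pow_pos (hl n) 2).le)
  · rw [key]
    refine add_le_add (mul_le_mul ?_ ?_ (div_nonneg (h1 _ (hz n)) (hl n).le) ?_)
      ((hupp n).trans (hdq n))
    · exact (div_le_div_of_nonneg_right (one_sub_exp_neg_le _) (hl n).le).trans (hya n)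
    · exact (div_le_div_of_nonneg_right (one_sub_exp_neg_le _) (hl n).le).trans (hzb n)
    · exact (div_nonneg (hy n) (hl n).le).trans (hya n)
  · simp_rw [key]
    have sq : ∀ {x : ℕ → ℝ} {m : ℝ}, (∀ n, 0 ≤ x n) → Tendsto (fun n => x n / l n) atTop (𝓝 m) →
        Tendsto (fun n => (1 - Real.exp (-x n)) / l n) atTop (𝓝 m) := fun hx hm =>
      tendsto_div_of_squeeze (φ := fun y => 1 - Real.exp (-y))
        (fun _ => div_one_add_le_one_sub_exp_neg) (fun y _ => one_sub_exp_neg_le y) hl hl0 hx hm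
    refine ((sq hy hyt).mul (sq hz hzt)).add ?_
    refine tendsto_of_tendsto_of_tendsto_of_le_of_le ?_ hdt hlow hupp
    simpa using hsum.mul hdt

end Exponent

/-! ### Bounded test functions with bounded support -/

section BoundedFunctions

variable {Θ : Type*} [MetricSpace Θ] [MeasurableSpace Θ] {f g : Θ → ℝ}

theorem IsBMPlus.const_mul (hf : IsBMPlus f) {r : ℝ} (hr : 0 ≤ r) :
    IsBMPlus (fun θ => r * f θ) := by
  obtain ⟨hm, h0, ⟨C, hC⟩, hb⟩ := hf
  exact ⟨hm.const_mul r, fun θ => mul_nonneg hr (h0 θ),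
    ⟨r * C, fun θ => mul_le_mul_of_nonneg_left (hC θ) hr⟩,
    hb.subset (Function.support_mul_subset_right _ _)⟩

theorem IsBMPlus.add (hf : IsBMPlus f) (hg : IsBMPlus g) : IsBMPlus (fun θ => f θ + g θ) := by
  obtain ⟨hm, h0, ⟨C, hC⟩, hb⟩ := hf
  obtain ⟨hm', h0', ⟨C', hC'⟩, hb'⟩ := hg
  exact ⟨hm.add hm', fun θ => add_nonneg (h0 θ) (h0' θ),
    ⟨C + C', fun θ => add_le_add (hC θ) (hC' θ)⟩,
    (hb.union hb').subset (Function.support_add _ _)⟩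

theorem IsBMPlus.mul (hf : IsBMPlus f) (hg : IsBMPlus g) : IsBMPlus (fun θ => f θ * g θ) := by
  obtain ⟨hm, h0, ⟨C, hC⟩, hb⟩ := hf
  obtain ⟨hm', h0', ⟨C', hC'⟩, hb'⟩ := hg
  exact ⟨hm.mul hm', fun θ => mul_nonneg (h0 θ) (h0' θ),
    ⟨C * C', fun θ => mul_le_mul (hC θ) (hC' θ) (h0' θ) ((h0 θ).trans (hC θ))⟩,
    hb.subset (Function.support_mul_subset_left _ _)⟩

theorem IsBMPlus.integrable (hf : IsBMPlus f) {ν : Measure Θ} (hν : BoundedlyFinite ν) :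
    Integrable f ν := by
  obtain ⟨hm, h0, ⟨C, hC⟩, hb⟩ := hf
  have hs : MeasurableSet (Function.support f) := measurableSet_support hm
  refine (integrableOn_iff_integrable_of_support_subset (s := Function.support f) le_rfl).1 ?_
  refine Measure.integrableOn_of_bounded (M := C) (hν _ hs hb).ne hm.aestronglyMeasurable ?_
  exact ae_of_all _ fun θ => by rw [Real.norm_of_nonneg (h0 θ)]; exact hC θ

theorem BoundedlyFinite.smul {ν : Measure Θ} (hν : BoundedlyFinite ν) (r : ℝ) :
    BoundedlyFinite (ENNReal.ofReal r • ν) := fun B hB hb => by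
  rw [Measure.smul_apply, smul_eq_mul]
  exact ENNReal.mul_lt_top ENNReal.ofReal_lt_top (hν B hB hb)

theorem IsBMPlus.ofReal_integral (hf : IsBMPlus f) {ν : Measure Θ} (hν : BoundedlyFinite ν) :
    ENNReal.ofReal (∫ θ, f θ ∂ν) = ∫⁻ θ, ENNReal.ofReal (f θ) ∂ν :=
  ofReal_integral_eq_lintegral_ofReal (hf.integrable hν) (ae_of_all _ hf.2.1)

end BoundedFunctions

/-! ### The filtration generated by the process -/

section Past

variable {Ω Θ : Type*} [MeasurableSpace Θ]

theorem measurable_past (W : ℕ → Ω → Measure Θ) {s t : ℕ} (hs : 1 ≤ s) (hst : s ≤ t) :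
    Measurable[past W t] (W s) :=
  (comap_measurable (W s)).mono
    (le_iSup₂ (f := fun s (_ : s ∈ Set.Icc 1 t) => MeasurableSpace.comap (W s) inferInstance)
      s ⟨hs, hst⟩) le_rfl

theorem past_mono (W : ℕ → Ω → Measure Θ) {s t : ℕ} (hst : s ≤ t) : past W s ≤ past W t :=
  iSup₂_le fun r hr => le_iSup₂
    (f := fun s (_ : s ∈ Set.Icc 1 t) => MeasurableSpace.comap (W s) inferInstance)
    r ⟨hr.1, hr.2.trans hst⟩

end Past

/-! ### One-step conditional moments for test functions -/

section OneStep

variable {Ω Θ : Type*} [mΩ : MeasurableSpace Ω] [MetricSpace Θ] [MeasurableSpace Θ]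
  {P : Measure Ω} {H : Measure Θ} {β c : ℕ → ℝ} {W : ℕ → Ω → Measure Θ}

theorem IsMARG.past_le (hW : IsMARG P H β c W) (t : ℕ) : past W t ≤ mΩ :=
  iSup₂_le fun s hs => (hW.measurable s hs.1).comap_le

theorem integrable_exp_neg {μ : Measure Ω} [IsFiniteMeasure μ] {X : Ω → ℝ} (hX : Measurable X)
    (h0 : ∀ ω, 0 ≤ X ω) : Integrable (fun ω => Real.exp (-X ω)) μ := by
  refine Integrable.of_bound (C := 1) (by fun_prop) (ae_of_all _ fun ω => ?_)
  rw [Real.norm_of_nonneg (Real.exp_pos _).le]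
  exact Real.exp_le_one_iff.2 (neg_nonpos.2 (h0 ω))

theorem IsMARG.measurable_integral (hW : IsMARG P H β c W) {t : ℕ} (ht : 1 ≤ t) {g : Θ → ℝ}
    (hg : Measurable g) : Measurable (fun ω => ∫ θ, g θ ∂(W t ω)) :=
  (measurable_integral_measure hg).comp (hW.measurable t ht)

theorem IsMARG.measurable_exponent (hW : IsMARG P H β c W) {t : ℕ} (ht : 1 ≤ t) {b r : ℝ}
    {f : Θ → ℝ} (hf : Measurable f) :
    Measurable (fun ω => ncGammaExponent H (ENNReal.ofReal b • W t ω) r f) := by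
  simp only [ncGammaExponent, integral_smul_measure]
  have hm : Measurable (fun θ => r * f θ / (1 + r * f θ)) := by fun_prop
  exact ((hW.measurable_integral ht hm).const_smul (ENNReal.ofReal b).toReal).const_add _

/-- Conditional Laplace functional of `W_{t+1}` given the past, in integrated form. -/
theorem IsMARG.setIntegral_exp [IsProbabilityMeasure P] (hW : IsMARG P H β c W) {t : ℕ}
    (ht : 1 ≤ t) {f : Θ → ℝ} (hf : IsBMPlus f) {A : Set Ω} (hA : MeasurableSet[past W t] A) :
    ∫ ω in A, Real.exp (-∫ θ, f θ ∂(W (t + 1) ω)) ∂P =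
      ∫ ω in A, Real.exp (-ncGammaExponent H (ENNReal.ofReal (β (t + 1)) • W t ω)
        (c (t + 1)) f) ∂P := by
  -- The transition law conditions on `W t` alone. The Markov property, applied to this functional
  -- with values in (0, 1], lets the whole past take its place.
  have hmk := hW.markov t ht (fun ν => Real.exp (-∫ θ, f θ ∂ν))
    (measurable_integral_measure hf.1).neg.exp ⟨1, fun ν => by
      rw [abs_of_pos (Real.exp_pos _)]
      exact Real.exp_le_one_iff.2 (neg_nonpos.2 (integral_nonneg hf.2.1))⟩
  have htr := hmk.trans (hW.transition t ht f hf)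
  simp_rw [ncGammaLaplace_eq] at htr
  rw [← setIntegral_condExp (hW.past_le t) (integrable_exp_neg
    (hW.measurable_integral (by omega) hf.1) fun ω => integral_nonneg hf.2.1) hA]
  exact integral_congr_ae (ae_restrict_of_ae htr)

theorem lintegral_ofReal_congr {μ : Measure Ω} {U V : Ω → ℝ} (hU : Integrable U μ)
    (hV : Integrable V μ) (hU0 : ∀ ω, 0 ≤ U ω) (hV0 : ∀ ω, 0 ≤ V ω)
    (h : ∫ ω, U ω ∂μ = ∫ ω, V ω ∂μ) :
    ∫⁻ ω, ENNReal.ofReal (U ω) ∂μ = ∫⁻ ω, ENNReal.ofReal (V ω) ∂μ := by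
  rw [← ofReal_integral_eq_lintegral_ofReal hU (ae_of_all _ hU0),
    ← ofReal_integral_eq_lintegral_ofReal hV (ae_of_all _ hV0), h]

theorem one_div_succ_pos (n : ℕ) : (0 : ℝ) < 1 / ((n : ℝ) + 1) := by positivity

/-- Difference quotients at zero of both sides of the Laplace identity along `l n * f`. Each
quotient is at most its limit, so no finite mean is needed. -/
theorem IsMARG.setLIntegral_mean_of_bounded [IsProbabilityMeasure P] (hW : IsMARG P H β c W)
    {t : ℕ} (ht : 1 ≤ t) {f : Θ → ℝ} (hf : IsBMPlus f) {A : Set Ω}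
    (hA : MeasurableSet[past W t] A) :
    ∫⁻ ω in A, ENNReal.ofReal (∫ θ, f θ ∂(W (t + 1) ω)) ∂P =
      ∫⁻ ω in A, ENNReal.ofReal (c (t + 1) * ∫ θ, f θ ∂H +
        c (t + 1) * ∫ θ, f θ ∂(ENNReal.ofReal (β (t + 1)) • W t ω)) ∂P := by
  have hc := hW.c_pos (t + 1) (by omega)
  set l : ℕ → ℝ := fun n => 1 / ((n : ℝ) + 1) with hl_def
  have hl : ∀ n, 0 < l n := one_div_succ_pos
  have hl0 : Tendsto l atTop (𝓝 0) := tendsto_one_div_add_atTop_nhds_zero_nat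
  have hfl : ∀ n, IsBMPlus (fun θ => l n * f θ) := fun n => hf.const_mul (hl n).le
  have hfin : ∀ ω, BoundedlyFinite (ENNReal.ofReal (β (t + 1)) • W t ω) := fun ω =>
    (hW.finite t ht ω).smul _
  have hX0 : ∀ n ω, 0 ≤ ∫ θ, l n * f θ ∂(W (t + 1) ω) := fun n ω =>
    integral_nonneg (hfl n).2.1
  have hY0 : ∀ n ω, 0 ≤ ncGammaExponent H (ENNReal.ofReal (β (t + 1)) • W t ω) (c (t + 1))
      (fun θ => l n * f θ) := fun n ω => ncGammaExponent_nonneg _ _ hc (hfl n).2.1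
  have hXm : ∀ n, Measurable fun ω => ∫ θ, l n * f θ ∂(W (t + 1) ω) := fun n =>
    hW.measurable_integral (by omega) (hfl n).1
  have hYm : ∀ n, Measurable fun ω => ncGammaExponent H (ENNReal.ofReal (β (t + 1)) • W t ω)
      (c (t + 1)) (fun θ => l n * f θ) := fun n => hW.measurable_exponent ht (hfl n).1
  have hXeq : ∀ n ω, (∫ θ, l n * f θ ∂(W (t + 1) ω)) / l n = ∫ θ, f θ ∂(W (t + 1) ω) := by
    intro n ω
    rw [integral_const_mul, mul_div_cancel_left₀ _ (hl n).ne']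
  have hYt : ∀ ω, Tendsto (fun n => ncGammaExponent H (ENNReal.ofReal (β (t + 1)) • W t ω)
      (c (t + 1)) (fun θ => l n * f θ) / l n) atTop _ := fun ω =>
    tendsto_ncGammaExponent_div hc hf.1 hf.2.1 (hf.integrable hW.base_finite)
      (hf.integrable (hfin ω)) hl hl0
  have hYle : ∀ n ω, ncGammaExponent H (ENNReal.ofReal (β (t + 1)) • W t ω)
      (c (t + 1)) (fun θ => l n * f θ) / l n ≤ c (t + 1) * ∫ θ, f θ ∂H +
        c (t + 1) * ∫ θ, f θ ∂(ENNReal.ofReal (β (t + 1)) • W t ω) := by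
    intro n ω
    rw [div_le_iff₀ (hl n)]
    refine (ncGammaExponent_le hc (hfl n).1 (hfl n).2.1 ((hfl n).integrable hW.base_finite)
      ((hfl n).integrable (hfin ω))).trans_eq ?_
    rw [integral_const_mul, integral_const_mul]; ring
  have key : ∀ {x : ℕ → ℝ} {m : ℝ}, (∀ n, 0 ≤ x n) → Tendsto (fun n => x n / l n) atTop (𝓝 m) →
      Tendsto (fun n => (1 - Real.exp (-x n)) / l n) atTop (𝓝 m) := fun hx hm =>
    tendsto_div_of_squeeze (φ := fun y => 1 - Real.exp (-y))
      (fun _ => div_one_add_le_one_sub_exp_neg) (fun y _ => one_sub_exp_neg_le y) hl hl0 hx hm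
  have hle : ∀ (x : ℝ) n, (1 - Real.exp (-x)) / l n ≤ x / l n := fun x n =>
    div_le_div_of_nonneg_right (one_sub_exp_neg_le x) (hl n).le
  have hnn : ∀ {x : ℝ} (n), 0 ≤ x → 0 ≤ (1 - Real.exp (-x)) / l n := fun n hx =>
    div_nonneg (sub_nonneg.2 (Real.exp_le_one_iff.2 (neg_nonpos.2 hx))) (hl n).le
  refine lintegral_eq_of_tendsto_of_le
    (U := fun n ω => ENNReal.ofReal ((1 - Real.exp (-∫ θ, l n * f θ ∂(W (t + 1) ω))) / l n))
    (V := fun n ω => ENNReal.ofReal ((1 - Real.exp (-ncGammaExponent H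
      (ENNReal.ofReal (β (t + 1)) • W t ω) (c (t + 1)) (fun θ => l n * f θ))) / l n))
    (fun n => (((hXm n).neg.exp.const_sub 1).div_const _).ennreal_ofReal)
    (fun n => (((hYm n).neg.exp.const_sub 1).div_const _).ennreal_ofReal)
    (fun n ω => ENNReal.ofReal_le_ofReal ((hle _ n).trans_eq (hXeq n ω)))
    (fun n ω => ENNReal.ofReal_le_ofReal ((hle _ n).trans (hYle n ω)))
    (fun ω => ENNReal.tendsto_ofReal (key (fun n => hX0 n ω) ?_))
    (fun ω => ENNReal.tendsto_ofReal (key (fun n => hY0 n ω) (hYt ω))) (fun n => ?_)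
  · simp_rw [hXeq]; exact tendsto_const_nhds
  · have i1 := integrable_exp_neg (μ := P.restrict A) (hXm n) (hX0 n)
    have i2 := integrable_exp_neg (μ := P.restrict A) (hYm n) (hY0 n)
    refine lintegral_ofReal_congr (((integrable_const 1).sub i1).div_const _)
      (((integrable_const 1).sub i2).div_const _) (fun ω => hnn n (hX0 n ω))
      (fun ω => hnn n (hY0 n ω)) ?_
    rw [integral_div, integral_div, integral_sub (integrable_const 1) i1,
      integral_sub (integrable_const 1) i2, hW.setIntegral_exp ht (hfl n) hA]

/-- The same argument with the mixed second difference in the directions `f` and `g`, which uses the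
Laplace identity at `f`, `g` and `f + g`. -/
theorem IsMARG.setLIntegral_mul_of_bounded [IsProbabilityMeasure P] (hW : IsMARG P H β c W)
    {t : ℕ} (ht : 1 ≤ t) {f g : Θ → ℝ} (hf : IsBMPlus f) (hg : IsBMPlus g) {A : Set Ω}
    (hA : MeasurableSet[past W t] A) :
    ∫⁻ ω in A, ENNReal.ofReal ((∫ θ, f θ ∂(W (t + 1) ω)) * ∫ θ, g θ ∂(W (t + 1) ω)) ∂P =
      ∫⁻ ω in A, ENNReal.ofReal ((c (t + 1) * ∫ θ, f θ ∂H +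
          c (t + 1) * ∫ θ, f θ ∂(ENNReal.ofReal (β (t + 1)) • W t ω)) *
        (c (t + 1) * ∫ θ, g θ ∂H +
          c (t + 1) * ∫ θ, g θ ∂(ENNReal.ofReal (β (t + 1)) • W t ω)) +
        (c (t + 1) ^ 2 * ∫ θ, f θ * g θ ∂H +
          2 * c (t + 1) ^ 2 * ∫ θ, f θ * g θ ∂(ENNReal.ofReal (β (t + 1)) • W t ω))) ∂P := by
  have hc := hW.c_pos (t + 1) (by omega)
  set l : ℕ → ℝ := fun n => 1 / ((n : ℝ) + 1) with hl_def
  have hl : ∀ n, 0 < l n := one_div_succ_pos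
  have hl0 : Tendsto l atTop (𝓝 0) := tendsto_one_div_add_atTop_nhds_zero_nat
  have hfin : ∀ ω, BoundedlyFinite (ENNReal.ofReal (β (t + 1)) • W t ω) := fun ω =>
    (hW.finite t ht ω).smul _
  have hlf : ∀ {f : Θ → ℝ}, IsBMPlus f → ∀ n, IsBMPlus (fun θ => l n * f θ) := fun hf n =>
    hf.const_mul (hl n).le
  have hlfg : ∀ n, IsBMPlus (fun θ => l n * f θ + l n * g θ) := fun n => (hlf hf n).add (hlf hg n)
  have hX0 : ∀ {f : Θ → ℝ}, IsBMPlus f → ∀ ω, 0 ≤ ∫ θ, f θ ∂(W (t + 1) ω) := fun hf ω =>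
    integral_nonneg hf.2.1
  have hY0 : ∀ {f : Θ → ℝ}, IsBMPlus f → ∀ ω, 0 ≤ ncGammaExponent H
      (ENNReal.ofReal (β (t + 1)) • W t ω) (c (t + 1)) f := fun hf ω =>
    ncGammaExponent_nonneg _ _ hc hf.2.1
  have hXm : ∀ {f : Θ → ℝ}, IsBMPlus f → Measurable fun ω => ∫ θ, f θ ∂(W (t + 1) ω) :=
    fun hf => hW.measurable_integral (by omega) hf.1
  have hYm : ∀ {f : Θ → ℝ}, IsBMPlus f → Measurable fun ω => ncGammaExponent H
      (ENNReal.ofReal (β (t + 1)) • W t ω) (c (t + 1)) f := fun hf =>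
    hW.measurable_exponent ht hf.1
  have hXeq : ∀ (f : Θ → ℝ) n ω, (∫ θ, l n * f θ ∂(W (t + 1) ω)) / l n =
      ∫ θ, f θ ∂(W (t + 1) ω) := by
    intro f n ω
    rw [integral_const_mul, mul_div_cancel_left₀ _ (hl n).ne']
  have hYt : ∀ {f : Θ → ℝ}, IsBMPlus f → ∀ ω, Tendsto (fun n => ncGammaExponent H
      (ENNReal.ofReal (β (t + 1)) • W t ω) (c (t + 1)) (fun θ => l n * f θ) / l n) atTop
      (𝓝 (c (t + 1) * ∫ θ, f θ ∂H +
        c (t + 1) * ∫ θ, f θ ∂(ENNReal.ofReal (β (t + 1)) • W t ω))) := fun hf ω =>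
    tendsto_ncGammaExponent_div hc hf.1 hf.2.1 (hf.integrable hW.base_finite)
      (hf.integrable (hfin ω)) hl hl0
  have hYle : ∀ {f : Θ → ℝ}, IsBMPlus f → ∀ ω n, ncGammaExponent H
      (ENNReal.ofReal (β (t + 1)) • W t ω) (c (t + 1)) (fun θ => l n * f θ) / l n ≤
      c (t + 1) * ∫ θ, f θ ∂H +
        c (t + 1) * ∫ θ, f θ ∂(ENNReal.ofReal (β (t + 1)) • W t ω) := by
    intro f hf ω n
    rw [div_le_iff₀ (hl n)]
    refine (ncGammaExponent_le hc (hlf hf n).1 (hlf hf n).2.1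
      ((hlf hf n).integrable hW.base_finite) ((hlf hf n).integrable (hfin ω))).trans_eq ?_
    rw [integral_const_mul, integral_const_mul]; ring
  have hXadd : ∀ n ω, ∫ θ, l n * f θ + l n * g θ ∂(W (t + 1) ω) =
      ∫ θ, l n * f θ ∂(W (t + 1) ω) + ∫ θ, l n * g θ ∂(W (t + 1) ω) := fun n ω =>
    integral_add ((hlf hf n).integrable (hW.finite _ (by omega) ω))
      ((hlf hg n).integrable (hW.finite _ (by omega) ω))
  -- For the process itself integration is additive, so the defect is zero and the limit is the
  -- plain product.
  have hXb := fun ω => second_difference_bounds (q := 0)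
    (y := fun n => ∫ θ, l n * f θ ∂(W (t + 1) ω)) (z := fun n => ∫ θ, l n * g θ ∂(W (t + 1) ω))
    (w := fun n => ∫ θ, l n * f θ + l n * g θ ∂(W (t + 1) ω)) hl hl0
    (fun n => hX0 (hlf hf n) ω) (fun n => hX0 (hlf hg n) ω) (fun n => hX0 (hlfg n) ω)
    (fun n => (hXeq f n ω).le) (fun n => (hXeq g n ω).le)
    (fun n => by simp [hXadd]) (fun n => by simp [hXadd])
    (by simp_rw [hXeq]; exact tendsto_const_nhds) (by simp_rw [hXeq]; exact tendsto_const_nhds)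
    (by simp [hXadd])
  -- For the exponent the defect survives and supplies the conditional covariance.
  have hYb := fun ω =>
    have hd := tendsto_ncGammaExponent_defect_div (H := H)
      (M := ENNReal.ofReal (β (t + 1)) • W t ω) hc hf.1 hf.2.1 (hf.integrable hW.base_finite)
      (hf.integrable (hfin ω)) hg.1 hg.2.1 (hg.integrable hW.base_finite)
      (hg.integrable (hfin ω)) ((hf.mul hg).integrable hW.base_finite)
      ((hf.mul hg).integrable (hfin ω)) hl hl0
    second_difference_bounds hl hl0 (fun n => hY0 (hlf hf n) ω) (fun n => hY0 (hlf hg n) ω)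
      (fun n => hY0 (hlfg n) ω) (hYle hf ω) (hYle hg ω) hd.1 hd.2.1 (hYt hf ω) (hYt hg ω) hd.2.2
  simp only [add_zero] at hXb
  have meas : ∀ {x y z : Ω → ℝ} (r : ℝ), Measurable x → Measurable y → Measurable z →
      Measurable fun ω => ENNReal.ofReal
        ((1 - Real.exp (-x ω) - Real.exp (-y ω) + Real.exp (-z ω)) / r) := by
    intro x y z r hx hy hz
    fun_prop
  refine lintegral_eq_of_tendsto_of_le
    (fun n => meas (l n ^ 2) (hXm (hlf hf n)) (hXm (hlf hg n)) (hXm (hlfg n)))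
    (fun n => meas (l n ^ 2) (hYm (hlf hf n)) (hYm (hlf hg n)) (hYm (hlfg n)))
    (fun n ω => ENNReal.ofReal_le_ofReal ((hXb ω).2.1 n))
    (fun n ω => ENNReal.ofReal_le_ofReal ((hYb ω).2.1 n))
    (fun ω => ENNReal.tendsto_ofReal (hXb ω).2.2)
    (fun ω => ENNReal.tendsto_ofReal (hYb ω).2.2) (fun n => ?_)
  have i1 : Integrable (fun _ : Ω => (1 : ℝ)) (P.restrict A) := integrable_const 1
  have iX : ∀ {f : Θ → ℝ}, IsBMPlus f → Integrable (fun ω =>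
      Real.exp (-∫ θ, f θ ∂(W (t + 1) ω))) (P.restrict A) := fun hf =>
    integrable_exp_neg (hXm hf) (hX0 hf)
  have iY : ∀ {f : Θ → ℝ}, IsBMPlus f → Integrable (fun ω => Real.exp (-ncGammaExponent H
      (ENNReal.ofReal (β (t + 1)) • W t ω) (c (t + 1)) f)) (P.restrict A) := fun hf =>
    integrable_exp_neg (hYm hf) (hY0 hf)
  have comb : ∀ {x y z : Ω → ℝ}, Integrable x (P.restrict A) → Integrable y (P.restrict A) →
      Integrable z (P.restrict A) → Integrable (fun ω => (1 - x ω - y ω + z ω) / l n ^ 2)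
        (P.restrict A) ∧ ∫ ω in A, (1 - x ω - y ω + z ω) / l n ^ 2 ∂P =
        (∫ _ in A, 1 ∂P - ∫ ω in A, x ω ∂P - ∫ ω in A, y ω ∂P + ∫ ω in A, z ω ∂P) / l n ^ 2 := by
    intro x y z hx hy hz
    refine ⟨(((i1.sub hx).sub hy).add hz).div_const _, ?_⟩
    have i2 : Integrable (fun ω => 1 - x ω) (P.restrict A) := i1.sub hx
    have i3 : Integrable (fun ω => 1 - x ω - y ω) (P.restrict A) := i2.sub hy
    rw [integral_div, integral_add i3 hz, integral_sub i2 hy, integral_sub i1 hx]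
  refine lintegral_ofReal_congr (comb (iX (hlf hf n)) (iX (hlf hg n)) (iX (hlfg n))).1
    (comb (iY (hlf hf n)) (iY (hlf hg n)) (iY (hlfg n))).1 (fun ω => (hXb ω).1 n)
    (fun ω => (hYb ω).1 n) ?_
  rw [(comb (iX (hlf hf n)) (iX (hlf hg n)) (iX (hlfg n))).2,
    (comb (iY (hlf hf n)) (iY (hlf hg n)) (iY (hlfg n))).2, hW.setIntegral_exp ht (hlf hf n) hA,
    hW.setIntegral_exp ht (hlf hg n) hA, hW.setIntegral_exp ht (hlfg n) hA]

end OneStep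

/-! ### Monotone approximation of functions with values in [0, ∞] -/

section Increasing

/-- The sequence `a` increases to `L`. -/
def IncreasesTo (a : ℕ → ENNReal) (L : ENNReal) : Prop := Monotone a ∧ ⨆ n, a n = L

variable {a b : ℕ → ENNReal} {L K : ENNReal}

theorem IncreasesTo.const (L : ENNReal) : IncreasesTo (fun _ => L) L :=
  ⟨monotone_const, iSup_const⟩

theorem IncreasesTo.add (ha : IncreasesTo a L) (hb : IncreasesTo b K) :
    IncreasesTo (fun n => a n + b n) (L + K) :=
  ⟨ha.1.add hb.1, by rw [← ha.2, ← hb.2, ENNReal.iSup_add_iSup_of_monotone ha.1 hb.1]⟩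

/-- Valid also for 0 · ∞, where multiplication is discontinuous; this is why suprema of increasing
sequences are used instead of limits. Monotonicity reduces the double supremum to the diagonal. -/
theorem IncreasesTo.mul (ha : IncreasesTo a L) (hb : IncreasesTo b K) :
    IncreasesTo (fun n => a n * b n) (L * K) := by
  refine ⟨fun m n h => mul_le_mul' (ha.1 h) (hb.1 h), le_antisymm ?_ ?_⟩
  · rw [← ha.2, ← hb.2]
    exact iSup_le fun n => mul_le_mul' (le_iSup a n) (le_iSup b n)
  · rw [← ha.2, ← hb.2, ENNReal.iSup_mul]
    refine iSup_le fun i => ?_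
    rw [ENNReal.mul_iSup]
    exact iSup_le fun j => (mul_le_mul' (ha.1 (le_max_left i j)) (hb.1 (le_max_right i j))).trans
      (le_iSup (fun n => a n * b n) (max i j))

theorem IncreasesTo.lintegral {α : Type*} [MeasurableSpace α] {μ : Measure α}
    {f : ℕ → α → ENNReal} {F : α → ENNReal} (hm : ∀ n, Measurable (f n))
    (h : ∀ x, IncreasesTo (fun n => f n x) (F x)) :
    IncreasesTo (fun n => ∫⁻ x, f n x ∂μ) (∫⁻ x, F x ∂μ) := by
  refine ⟨fun m n hmn => lintegral_mono fun x => (h x).1 hmn, ?_⟩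
  rw [← lintegral_iSup hm fun m n hmn x => (h x).1 hmn]
  exact lintegral_congr fun x => (h x).2

/-- Cut `g` at height n and restrict it to the ball of radius n about a fixed centre, which exists
unless `Θ` is empty. Every point is eventually in the ball. -/
theorem exists_isBMPlus_increasesTo {Θ : Type*} [MetricSpace Θ] [MeasurableSpace Θ]
    [OpensMeasurableSpace Θ] {g : Θ → ENNReal} (hg : Measurable g) :
    ∃ f : ℕ → Θ → ℝ, (∀ n, IsBMPlus (f n)) ∧
      ∀ θ, IncreasesTo (fun n => ENNReal.ofReal (f n θ)) (g θ) := by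
  rcases isEmpty_or_nonempty Θ with hΘ | ⟨⟨x⟩⟩
  · exact ⟨fun _ _ => 0, fun n => ⟨measurable_const, fun _ => le_rfl, ⟨0, fun _ => le_rfl⟩,
      by simp⟩, fun θ => isEmptyElim θ⟩
  refine ⟨fun n => (Metric.ball x n).indicator fun θ => (min (g θ) n).toReal, fun n => ?_,
    fun θ => ?_⟩
  · refine ⟨(hg.min measurable_const).ennreal_toReal.indicator measurableSet_ball,
      fun θ => Set.indicator_nonneg (fun _ _ => ENNReal.toReal_nonneg) θ, ⟨n, fun θ => ?_⟩,
      Metric.isBounded_ball.subset Set.support_indicator_subset⟩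
    refine Set.indicator_apply_le' (fun _ => ?_) (fun _ => by positivity)
    have := ENNReal.toReal_mono (ENNReal.natCast_ne_top n) (min_le_right (g θ) n)
    simpa using this
  · have e : ∀ n : ℕ, ENNReal.ofReal ((Metric.ball x n).indicator
        (fun θ => (min (g θ) n).toReal) θ) = if dist θ x < n then min (g θ) n else 0 := by
      intro n
      have hne : min (g θ) n ≠ ⊤ := ne_top_of_le_ne_top (ENNReal.natCast_ne_top n) (min_le_right _ _)
      by_cases h : dist θ x < n
      · simp [Set.indicator, h, ENNReal.ofReal_toReal hne]
      · simp [Set.indicator, h]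
    simp_rw [e]
    have hmono : Monotone fun n : ℕ => if dist θ x < n then min (g θ) n else 0 := by
      intro m n hmn
      have hc : (m : ℝ) ≤ n := by exact_mod_cast hmn
      have hc' : (m : ENNReal) ≤ n := by exact_mod_cast hmn
      by_cases h : dist θ x < m
      · simp only [h, h.trans_le hc, if_true]
        exact min_le_min le_rfl hc'
      · simp [h]
    refine ⟨hmono, tendsto_nhds_unique (tendsto_atTop_iSup hmono) ?_⟩
    obtain ⟨N, hN⟩ := exists_nat_gt (dist θ x)
    have h1 : Tendsto (fun n : ℕ => min (g θ) (n : ENNReal)) atTop (𝓝 (min (g θ) ⊤)) :=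
      tendsto_const_nhds.min ENNReal.tendsto_nat_nhds_top
    rw [min_eq_left le_top] at h1
    refine h1.congr' ?_
    filter_upwards [eventually_ge_atTop N] with n hn
    have hc : (N : ℝ) ≤ n := by exact_mod_cast hn
    rw [if_pos (hN.trans_le hc)]

end Increasing

/-! ### From events to nonnegative weights -/

section Weights

variable {Ω : Type*} {m mΩ : MeasurableSpace Ω} {P : Measure Ω}

/-- The densities `X` and `Y` define measures that agree on `m`, and integrating the `m`-measurable
`Z` sees only these restrictions. -/
theorem lintegral_mul_eq_of_setLIntegral_eq (hm : m ≤ mΩ) {X Y Z : Ω → ENNReal}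
    (hX : Measurable X) (hY : Measurable Y) (hZ : Measurable[m] Z)
    (h : ∀ A, MeasurableSet[m] A → ∫⁻ ω in A, X ω ∂P = ∫⁻ ω in A, Y ω ∂P) :
    ∫⁻ ω, Z ω * X ω ∂P = ∫⁻ ω, Z ω * Y ω ∂P := by
  have key : ∀ {X : Ω → ENNReal}, Measurable X →
      ∫⁻ ω, Z ω * X ω ∂P = ∫⁻ ω, Z ω ∂((P.withDensity X).trim hm) := by
    intro X hX
    rw [lintegral_trim hm hZ, lintegral_withDensity_eq_lintegral_mul _ hX (hZ.mono hm le_rfl)]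
    exact lintegral_congr fun ω => mul_comm _ _
  have e : (P.withDensity X).trim hm = (P.withDensity Y).trim hm := by
    refine @Measure.ext _ m _ _ fun A hA => ?_
    rw [trim_measurableSet_eq hm hA, trim_measurableSet_eq hm hA,
      withDensity_apply _ (hm A hA), withDensity_apply _ (hm A hA), h A hA]
  rw [key hX, key hY, e]

theorem lintegral_indicator_one_mul {Ω : Type*} [MeasurableSpace Ω] {P : Measure Ω}
    {A : Set Ω} (hA : MeasurableSet A) (F : Ω → ENNReal) :
    ∫⁻ ω, A.indicator 1 ω * F ω ∂P = ∫⁻ ω in A, F ω ∂P := by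
  rw [← lintegral_indicator hA]
  refine lintegral_congr fun ω => ?_
  by_cases hω : ω ∈ A <;> simp [hω]

end Weights

/-! ### Moment identities in [0, ∞] and their iteration in time -/

section Moments

theorem measurable_past_lintegral {Ω Θ : Type*} [MeasurableSpace Θ] (W : ℕ → Ω → Measure Θ)
    {s t : ℕ} (hs : 1 ≤ s) (hst : s ≤ t)
    {g : Θ → ENNReal} (hg : Measurable g) :
    Measurable[past W t] (fun ω => ∫⁻ θ, g θ ∂(W s ω)) :=
  (Measure.measurable_lintegral hg).comp (measurable_past W hs hst)

variable {Ω Θ : Type*} [mΩ : MeasurableSpace Ω] [MetricSpace Θ] [MeasurableSpace Θ]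
  {P : Measure Ω} {H : Measure Θ} {β c : ℕ → ℝ} {W : ℕ → Ω → Measure Θ}

theorem IsMARG.measurable_lintegral (hW : IsMARG P H β c W) {t : ℕ} (ht : 1 ≤ t)
    {g : Θ → ENNReal} (hg : Measurable g) : Measurable (fun ω => ∫⁻ θ, g θ ∂(W t ω)) :=
  (Measure.measurable_lintegral hg).comp (hW.measurable t ht)

theorem IsMARG.ofReal_mean (hW : IsMARG P H β c W) {t : ℕ} (ht : 1 ≤ t) {f : Θ → ℝ}
    (hf : IsBMPlus f) (ω : Ω) :
    ENNReal.ofReal (c (t + 1) * ∫ θ, f θ ∂H +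
        c (t + 1) * ∫ θ, f θ ∂(ENNReal.ofReal (β (t + 1)) • W t ω)) =
      ENNReal.ofReal (c (t + 1)) * ∫⁻ θ, ENNReal.ofReal (f θ) ∂H +
        ENNReal.ofReal (β (t + 1) * c (t + 1)) * ∫⁻ θ, ENNReal.ofReal (f θ) ∂(W t ω) := by
  have hc := (hW.c_pos (t + 1) (by omega)).le
  have hβ := (hW.β_pos (t + 1) (by omega)).le
  have h0 : ∀ ν : Measure Θ, 0 ≤ ∫ θ, f θ ∂ν := fun ν => integral_nonneg hf.2.1
  rw [ENNReal.ofReal_add (mul_nonneg hc (h0 _)) (mul_nonneg hc (h0 _)), ENNReal.ofReal_mul hc,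
    ENNReal.ofReal_mul hc, hf.ofReal_integral hW.base_finite,
    hf.ofReal_integral ((hW.finite t ht ω).smul _), lintegral_smul_measure, smul_eq_mul,
    ENNReal.ofReal_mul hβ]
  ring

/-- One-step conditional mean. -/
theorem IsMARG.lintegral_mul_succ [OpensMeasurableSpace Θ] [IsProbabilityMeasure P]
    (hW : IsMARG P H β c W) {t : ℕ} (ht : 1 ≤ t) {Z : Ω → ENNReal} (hZ : Measurable[past W t] Z)
    {g : Θ → ENNReal} (hg : Measurable g) :
    ∫⁻ ω, Z ω * ∫⁻ θ, g θ ∂(W (t + 1) ω) ∂P =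
      ∫⁻ ω, Z ω * (ENNReal.ofReal (c (t + 1)) * ∫⁻ θ, g θ ∂H +
        ENNReal.ofReal (β (t + 1) * c (t + 1)) * ∫⁻ θ, g θ ∂(W t ω)) ∂P := by
  have hmean : ∀ {g : Θ → ENNReal}, Measurable g → Measurable fun ω =>
      ENNReal.ofReal (c (t + 1)) * ∫⁻ θ, g θ ∂H +
        ENNReal.ofReal (β (t + 1) * c (t + 1)) * ∫⁻ θ, g θ ∂(W t ω) := fun hg =>
    ((hW.measurable_lintegral ht hg).const_mul _).const_add _
  refine lintegral_mul_eq_of_setLIntegral_eq (hW.past_le t)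
    (hW.measurable_lintegral (by omega) hg) (hmean hg) hZ fun A hA => ?_
  obtain ⟨f, hf, hfg⟩ := exists_isBMPlus_increasesTo hg
  have hfm : ∀ n, Measurable fun θ => ENNReal.ofReal (f n θ) := fun n => (hf n).1.ennreal_ofReal
  have hlim : ∀ ν : Measure Θ, IncreasesTo (fun n => ∫⁻ θ, ENNReal.ofReal (f n θ) ∂ν)
      (∫⁻ θ, g θ ∂ν) := fun ν => IncreasesTo.lintegral hfm hfg
  have h1 := IncreasesTo.lintegral (μ := P.restrict A)
    (fun n => hW.measurable_lintegral (t := t + 1) (by omega) (hfm n))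
    (fun ω => hlim (W (t + 1) ω))
  have h2 := IncreasesTo.lintegral (μ := P.restrict A) (fun n => hmean (hfm n))
    (fun ω => ((IncreasesTo.const (ENNReal.ofReal (c (t + 1)))).mul (hlim H)).add
      ((IncreasesTo.const (ENNReal.ofReal (β (t + 1) * c (t + 1)))).mul (hlim (W t ω))))
  rw [← h1.2, ← h2.2]
  congr 1
  funext n
  have h3 := hW.setLIntegral_mean_of_bounded ht (hf n) hA
  simp_rw [hW.ofReal_mean ht (hf n), (hf n).ofReal_integral (hW.finite (t + 1) (by omega) _)] at h3
  exact h3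

/-- One-step conditional second moment. -/
theorem IsMARG.lintegral_mul_mul_succ [OpensMeasurableSpace Θ] [IsProbabilityMeasure P]
    (hW : IsMARG P H β c W) {t : ℕ} (ht : 1 ≤ t) {Z : Ω → ENNReal} (hZ : Measurable[past W t] Z)
    {p q : Θ → ENNReal} (hp : Measurable p) (hq : Measurable q) :
    ∫⁻ ω, Z ω * ((∫⁻ θ, p θ ∂(W (t + 1) ω)) * ∫⁻ θ, q θ ∂(W (t + 1) ω)) ∂P =
      ∫⁻ ω, Z ω * ((ENNReal.ofReal (c (t + 1)) * ∫⁻ θ, p θ ∂H +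
          ENNReal.ofReal (β (t + 1) * c (t + 1)) * ∫⁻ θ, p θ ∂(W t ω)) *
        (ENNReal.ofReal (c (t + 1)) * ∫⁻ θ, q θ ∂H +
          ENNReal.ofReal (β (t + 1) * c (t + 1)) * ∫⁻ θ, q θ ∂(W t ω)) +
        (ENNReal.ofReal (c (t + 1)) ^ 2 * ∫⁻ θ, p θ * q θ ∂H +
          2 * ENNReal.ofReal (c (t + 1)) * ENNReal.ofReal (β (t + 1) * c (t + 1)) *
            ∫⁻ θ, p θ * q θ ∂(W t ω))) ∂P := by
  have hc := (hW.c_pos (t + 1) (by omega)).le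
  have hβ := (hW.β_pos (t + 1) (by omega)).le
  have hmean : ∀ {g : Θ → ENNReal}, Measurable g → Measurable fun ω =>
      ENNReal.ofReal (c (t + 1)) * ∫⁻ θ, g θ ∂H +
        ENNReal.ofReal (β (t + 1) * c (t + 1)) * ∫⁻ θ, g θ ∂(W t ω) := fun hg =>
    ((hW.measurable_lintegral ht hg).const_mul _).const_add _
  have hmm : ∀ {p q : Θ → ENNReal}, Measurable p → Measurable q → Measurable fun ω =>
      (ENNReal.ofReal (c (t + 1)) * ∫⁻ θ, p θ ∂H +
          ENNReal.ofReal (β (t + 1) * c (t + 1)) * ∫⁻ θ, p θ ∂(W t ω)) *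
        (ENNReal.ofReal (c (t + 1)) * ∫⁻ θ, q θ ∂H +
          ENNReal.ofReal (β (t + 1) * c (t + 1)) * ∫⁻ θ, q θ ∂(W t ω)) +
        (ENNReal.ofReal (c (t + 1)) ^ 2 * ∫⁻ θ, p θ * q θ ∂H +
          2 * ENNReal.ofReal (c (t + 1)) * ENNReal.ofReal (β (t + 1) * c (t + 1)) *
            ∫⁻ θ, p θ * q θ ∂(W t ω)) := fun hp hq =>
    ((hmean hp).mul (hmean hq)).add
      (((hW.measurable_lintegral ht (hp.mul hq)).const_mul _).const_add _)
  refine lintegral_mul_eq_of_setLIntegral_eq (hW.past_le t)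
    ((hW.measurable_lintegral (by omega) hp).mul (hW.measurable_lintegral (by omega) hq))
    (hmm hp hq) hZ fun A hA => ?_
  obtain ⟨f, hf, hfp⟩ := exists_isBMPlus_increasesTo hp
  obtain ⟨g, hg, hgq⟩ := exists_isBMPlus_increasesTo hq
  have hfm : ∀ n, Measurable fun θ => ENNReal.ofReal (f n θ) := fun n => (hf n).1.ennreal_ofReal
  have hgm : ∀ n, Measurable fun θ => ENNReal.ofReal (g n θ) := fun n => (hg n).1.ennreal_ofReal
  have hlf : ∀ ν : Measure Θ, IncreasesTo (fun n => ∫⁻ θ, ENNReal.ofReal (f n θ) ∂ν)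
      (∫⁻ θ, p θ ∂ν) := fun ν => IncreasesTo.lintegral hfm hfp
  have hlg : ∀ ν : Measure Θ, IncreasesTo (fun n => ∫⁻ θ, ENNReal.ofReal (g n θ) ∂ν)
      (∫⁻ θ, q θ ∂ν) := fun ν => IncreasesTo.lintegral hgm hgq
  have hlfg : ∀ ν : Measure Θ, IncreasesTo
      (fun n => ∫⁻ θ, ENNReal.ofReal (f n θ) * ENNReal.ofReal (g n θ) ∂ν)
      (∫⁻ θ, p θ * q θ ∂ν) := fun ν =>
    IncreasesTo.lintegral (fun n => (hfm n).mul (hgm n)) fun θ => (hfp θ).mul (hgq θ)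
  have h1 := IncreasesTo.lintegral (μ := P.restrict A)
    (fun n => (hW.measurable_lintegral (t := t + 1) (by omega) (hfm n)).mul
      (hW.measurable_lintegral (t := t + 1) (by omega) (hgm n)))
    (fun ω => (hlf (W (t + 1) ω)).mul (hlg (W (t + 1) ω)))
  have hk := fun x : ENNReal => IncreasesTo.const x
  have h2 := IncreasesTo.lintegral (μ := P.restrict A) (fun n => hmm (hfm n) (hgm n))
    (fun ω => ((((hk _).mul (hlf H)).add ((hk _).mul (hlf (W t ω)))).mul
      (((hk _).mul (hlg H)).add ((hk _).mul (hlg (W t ω))))).add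
      (((hk _).mul (hlfg H)).add ((hk _).mul (hlfg (W t ω)))))
  refine h1.2.symm.trans (Eq.trans ?_ h2.2)
  congr 1
  funext n
  have h3 := hW.setLIntegral_mul_of_bounded ht (hf n) (hg n) hA
  have hfg := (hf n).mul (hg n)
  have h0 : ∀ {f : Θ → ℝ}, IsBMPlus f → ∀ ν : Measure Θ, 0 ≤ ∫ θ, f θ ∂ν := fun hf ν =>
    integral_nonneg hf.2.1
  have e1 : ∀ ω, ENNReal.ofReal ((∫ θ, f n θ ∂(W (t + 1) ω)) * ∫ θ, g n θ ∂(W (t + 1) ω)) =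
      (∫⁻ θ, ENNReal.ofReal (f n θ) ∂(W (t + 1) ω)) *
        ∫⁻ θ, ENNReal.ofReal (g n θ) ∂(W (t + 1) ω) := fun ω => by
    rw [ENNReal.ofReal_mul (h0 (hf n) _), (hf n).ofReal_integral (hW.finite _ (by omega) ω),
      (hg n).ofReal_integral (hW.finite _ (by omega) ω)]
  -- The factor `β` moves out of the scaled measure `β • W t`, and 2c²β is regrouped as 2c(βc).
  have e2 : ∀ ω, ENNReal.ofReal (c (t + 1) ^ 2 * ∫ θ, f n θ * g n θ ∂H +
          2 * c (t + 1) ^ 2 * ∫ θ, f n θ * g n θ ∂(ENNReal.ofReal (β (t + 1)) • W t ω)) =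
      ENNReal.ofReal (c (t + 1)) ^ 2 * ∫⁻ θ, ENNReal.ofReal (f n θ) * ENNReal.ofReal (g n θ) ∂H +
        2 * ENNReal.ofReal (c (t + 1)) * ENNReal.ofReal (β (t + 1) * c (t + 1)) *
            ∫⁻ θ, ENNReal.ofReal (f n θ) * ENNReal.ofReal (g n θ) ∂(W t ω) := fun ω => by
    simp_rw [← ENNReal.ofReal_mul ((hf n).2.1 _)]
    rw [ENNReal.ofReal_add (mul_nonneg (by positivity) (h0 hfg _))
        (mul_nonneg (by positivity) (h0 hfg _)), ENNReal.ofReal_mul (by positivity),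
      ENNReal.ofReal_mul (by positivity), hfg.ofReal_integral hW.base_finite,
      hfg.ofReal_integral ((hW.finite t ht ω).smul _), lintegral_smul_measure, smul_eq_mul,
      ENNReal.ofReal_mul hβ, ENNReal.ofReal_mul zero_le_two, ENNReal.ofReal_pow hc,
      ENNReal.ofReal_ofNat]
    ring
  have hm0 : ∀ {f : Θ → ℝ}, IsBMPlus f → ∀ ν ν' : Measure Θ,
      0 ≤ c (t + 1) * ∫ θ, f θ ∂ν + c (t + 1) * ∫ θ, f θ ∂ν' := fun hf ν ν' =>
    add_nonneg (mul_nonneg hc (h0 hf _)) (mul_nonneg hc (h0 hf _))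
  have e3 : ∀ ω, _ := fun ω => ENNReal.ofReal_add
    (p := (c (t + 1) * ∫ θ, f n θ ∂H +
          c (t + 1) * ∫ θ, f n θ ∂(ENNReal.ofReal (β (t + 1)) • W t ω)) *
        (c (t + 1) * ∫ θ, g n θ ∂H +
          c (t + 1) * ∫ θ, g n θ ∂(ENNReal.ofReal (β (t + 1)) • W t ω)))
    (q := c (t + 1) ^ 2 * ∫ θ, f n θ * g n θ ∂H +
          2 * c (t + 1) ^ 2 * ∫ θ, f n θ * g n θ ∂(ENNReal.ofReal (β (t + 1)) • W t ω))
    (mul_nonneg (hm0 (hf n) _ _) (hm0 (hg n) _ _))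
    (add_nonneg (mul_nonneg (by positivity) (h0 hfg _)) (mul_nonneg (by positivity) (h0 hfg _)))
  simp_rw [e3, e1, e2, ENNReal.ofReal_mul (hm0 (hf n) _ _), hW.ofReal_mean ht (hf n),
    hW.ofReal_mean ht (hg n)] at h3
  exact h3

theorem IsMARG.lagRho_nonneg (hW : IsMARG P H β c W) {s t : ℕ} (ht : 1 ≤ t) :
    0 ≤ lagRho β c s t :=
  Finset.prod_nonneg fun j hj => by
    have := (Finset.mem_Icc.1 hj).1
    exact mul_nonneg (hW.β_pos j (by omega)).le (hW.c_pos j (by omega)).le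

theorem IsMARG.lagScale_nonneg (hW : IsMARG P H β c W) {s t : ℕ} (ht : 1 ≤ t) :
    0 ≤ lagScale β c s t :=
  Finset.sum_nonneg fun j hj => by
    have := (Finset.mem_Icc.1 hj).1
    exact mul_nonneg (hW.c_pos j (by omega)).le (hW.lagRho_nonneg (s := s) (t := j) (by omega))

theorem lagRho_succ (β c : ℕ → ℝ) {s t : ℕ} (h : t ≤ s) :
    lagRho β c (s + 1) t = β (s + 1) * c (s + 1) * lagRho β c s t := by
  rw [lagRho, Finset.prod_Icc_succ_top (by omega), lagRho, mul_comm]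

/-- One more step multiplies every old summand by the new ρ and adds a summand with empty product.
This is the composition rule for the affine maps x ↦ c + ρx. -/
theorem lagScale_succ (β c : ℕ → ℝ) {s t : ℕ} (h : t ≤ s) :
    lagScale β c (s + 1) t = c (s + 1) + β (s + 1) * c (s + 1) * lagScale β c s t := by
  rw [lagScale, Finset.sum_Icc_succ_top (by omega), lagScale, Finset.mul_sum, add_comm]
  congr 1
  · simp
  · refine Finset.sum_congr rfl fun j hj => ?_
    rw [Finset.prod_Icc_succ_top (by have := (Finset.mem_Icc.1 hj).2; omega)]
    ring

theorem IsMARG.ofReal_lagRho_succ (hW : IsMARG P H β c W) {s t : ℕ} (ht : 1 ≤ t) (h : t ≤ s) :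
    ENNReal.ofReal (lagRho β c (s + 1) t) =
      ENNReal.ofReal (β (s + 1) * c (s + 1)) * ENNReal.ofReal (lagRho β c s t) := by
  rw [lagRho_succ β c h, ENNReal.ofReal_mul]
  exact mul_nonneg (hW.β_pos _ (by omega)).le (hW.c_pos _ (by omega)).le

theorem IsMARG.ofReal_lagScale_succ (hW : IsMARG P H β c W) {s t : ℕ} (ht : 1 ≤ t) (h : t ≤ s) :
    ENNReal.ofReal (lagScale β c (s + 1) t) = ENNReal.ofReal (c (s + 1)) +
      ENNReal.ofReal (β (s + 1) * c (s + 1)) * ENNReal.ofReal (lagScale β c s t) := by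
  have h1 := (hW.c_pos (s + 1) (by omega)).le
  have h2 := mul_nonneg (hW.β_pos (s + 1) (by omega)).le h1
  rw [lagScale_succ β c h, ENNReal.ofReal_add h1 (mul_nonneg h2 (hW.lagScale_nonneg ht)),
    ENNReal.ofReal_mul h2]

/-- Conditional mean of `W_{t+h}` given the past of `W_t`. -/
theorem IsMARG.lintegral_mul_add [OpensMeasurableSpace Θ] [IsProbabilityMeasure P]
    (hW : IsMARG P H β c W) {t : ℕ} (ht : 1 ≤ t) {Z : Ω → ENNReal} (hZ : Measurable[past W t] Z)
    {g : Θ → ENNReal} (hg : Measurable g) (h : ℕ) :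
    ∫⁻ ω, Z ω * ∫⁻ θ, g θ ∂(W (t + h) ω) ∂P =
      ∫⁻ ω, Z ω * (ENNReal.ofReal (lagScale β c (t + h) t) * ∫⁻ θ, g θ ∂H +
        ENNReal.ofReal (lagRho β c (t + h) t) * ∫⁻ θ, g θ ∂(W t ω)) ∂P := by
  have hZm : Measurable Z := hZ.mono (hW.past_le t) le_rfl
  induction h with
  | zero => simp [lagRho_self, lagScale_self]
  | succ h ih =>
    have hWm := hW.measurable_lintegral (t := t + h) (by omega) hg
    have hWt := hW.measurable_lintegral ht hg
    have hZW : Measurable fun ω => Z ω * ∫⁻ θ, g θ ∂(W (t + h) ω) := hZm.mul hWm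
    rw [← add_assoc, hW.lintegral_mul_succ (by omega)
      (hZ.mono (past_mono W (by omega)) le_rfl) hg, hW.ofReal_lagRho_succ ht (by omega),
      hW.ofReal_lagScale_succ ht (by omega)]
    set a := ENNReal.ofReal (c (t + h + 1))
    set r := ENNReal.ofReal (β (t + h + 1) * c (t + h + 1))
    calc _ = ∫⁻ ω, (a * ∫⁻ θ, g θ ∂H) * Z ω + r * (Z ω * ∫⁻ θ, g θ ∂(W (t + h) ω)) ∂P :=
          lintegral_congr fun ω => by ring
      _ = ∫⁻ ω, (a * ∫⁻ θ, g θ ∂H) * Z ω + r * (Z ω *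
          (ENNReal.ofReal (lagScale β c (t + h) t) * ∫⁻ θ, g θ ∂H +
            ENNReal.ofReal (lagRho β c (t + h) t) * ∫⁻ θ, g θ ∂(W t ω))) ∂P := by
        rw [lintegral_add_left (hZm.const_mul _), lintegral_add_left (hZm.const_mul _),
          lintegral_const_mul r hZW, ih, lintegral_const_mul r (by fun_prop)]
      _ = _ := lintegral_congr fun ω => by ring

/-- The second-moment formula is stable under composition: substituting the time-t moments turns (C,
R) into (a + rC, rR). The coefficient of `w` becomes a² + 2arC + r²C² = (a + rC)², and that of `z'`
becomes 2arR + 2r²CR = 2(a + rC)(rR). -/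
theorem lintegral_second_moment_step {Z x y z x' y' z' : Ω → ENNReal}
    (hZ : Measurable Z) (hx : Measurable x) (hy : Measurable y) (hz : Measurable z)
    (hx' : Measurable x') (hy' : Measurable y') (hz' : Measurable z')
    {a r C R u v w : ENNReal}
    (ex : ∫⁻ ω, Z ω * x ω ∂P = ∫⁻ ω, Z ω * (C * u + R * x' ω) ∂P)
    (ey : ∫⁻ ω, Z ω * y ω ∂P = ∫⁻ ω, Z ω * (C * v + R * y' ω) ∂P)
    (ez : ∫⁻ ω, Z ω * z ω ∂P = ∫⁻ ω, Z ω * (C * w + R * z' ω) ∂P)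
    (exy : ∫⁻ ω, Z ω * (x ω * y ω) ∂P = ∫⁻ ω, Z ω * ((C * u + R * x' ω) * (C * v + R * y' ω) +
      (C ^ 2 * w + 2 * C * R * z' ω)) ∂P) :
    ∫⁻ ω, Z ω * ((a * u + r * x ω) * (a * v + r * y ω) + (a ^ 2 * w + 2 * a * r * z ω)) ∂P =
      ∫⁻ ω, Z ω * (((a + r * C) * u + r * R * x' ω) * ((a + r * C) * v + r * R * y' ω) +
        ((a + r * C) ^ 2 * w + 2 * (a + r * C) * (r * R) * z' ω)) ∂P := by
  -- Used twice: to expand the left side into monomials, and backwards to reassemble it after the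
  -- four moments have been replaced.
  have key : ∀ {f₁ f₂ f₃ f₄ : Ω → ENNReal}, Measurable f₁ → Measurable f₂ → Measurable f₃ →
      Measurable f₄ → ∫⁻ ω, (a ^ 2 * (u * v + w)) * Z ω + (r * a * v * (Z ω * f₁ ω) +
        (r * a * u * (Z ω * f₂ ω) + (2 * a * r * (Z ω * f₃ ω) + r ^ 2 * (Z ω * f₄ ω)))) ∂P =
      (a ^ 2 * (u * v + w)) * ∫⁻ ω, Z ω ∂P + (r * a * v * ∫⁻ ω, Z ω * f₁ ω ∂P +
        (r * a * u * ∫⁻ ω, Z ω * f₂ ω ∂P + (2 * a * r * ∫⁻ ω, Z ω * f₃ ω ∂P +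
          r ^ 2 * ∫⁻ ω, Z ω * f₄ ω ∂P))) := by
    intro f₁ f₂ f₃ f₄ h₁ h₂ h₃ h₄
    have m₁ : Measurable fun ω => Z ω * f₁ ω := hZ.mul h₁
    have m₂ : Measurable fun ω => Z ω * f₂ ω := hZ.mul h₂
    have m₃ : Measurable fun ω => Z ω * f₃ ω := hZ.mul h₃
    have m₄ : Measurable fun ω => Z ω * f₄ ω := hZ.mul h₄
    rw [lintegral_add_left (hZ.const_mul _), lintegral_add_left (m₁.const_mul _),
      lintegral_add_left (m₂.const_mul _), lintegral_add_left (m₃.const_mul _),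
      lintegral_const_mul _ hZ, lintegral_const_mul _ m₁, lintegral_const_mul _ m₂,
      lintegral_const_mul _ m₃, lintegral_const_mul _ m₄]
  have k1 := key hx hy hz (hx.mul hy)
  simp only [Pi.mul_apply] at k1
  rw [ex, ey, ez, exy, ← key (by fun_prop) (by fun_prop) (by fun_prop) (by fun_prop)] at k1
  calc _ = _ := lintegral_congr fun ω => by ring
    _ = _ := k1
    _ = _ := lintegral_congr fun ω => by ring

/-- Conditional second moment of `W_t` given `W_1`. -/
theorem IsMARG.lintegral_mul_mul [OpensMeasurableSpace Θ] [IsProbabilityMeasure P]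
    (hW : IsMARG P H β c W) {t : ℕ} (ht : 1 ≤ t) {Z : Ω → ENNReal} (hZ : Measurable[past W 1] Z)
    {p q : Θ → ENNReal} (hp : Measurable p) (hq : Measurable q) :
    ∫⁻ ω, Z ω * ((∫⁻ θ, p θ ∂(W t ω)) * ∫⁻ θ, q θ ∂(W t ω)) ∂P =
      ∫⁻ ω, Z ω * ((ENNReal.ofReal (lagScale β c t 1) * ∫⁻ θ, p θ ∂H +
          ENNReal.ofReal (lagRho β c t 1) * ∫⁻ θ, p θ ∂(W 1 ω)) *
        (ENNReal.ofReal (lagScale β c t 1) * ∫⁻ θ, q θ ∂H +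
          ENNReal.ofReal (lagRho β c t 1) * ∫⁻ θ, q θ ∂(W 1 ω)) +
        (ENNReal.ofReal (lagScale β c t 1) ^ 2 * ∫⁻ θ, p θ * q θ ∂H +
          2 * ENNReal.ofReal (lagScale β c t 1) * ENNReal.ofReal (lagRho β c t 1) *
            ∫⁻ θ, p θ * q θ ∂(W 1 ω))) ∂P := by
  have hZm : Measurable Z := hZ.mono (hW.past_le 1) le_rfl
  induction t, ht using Nat.le_induction with
  | base => simp [lagRho_self, lagScale_self]
  | succ t ht ih =>
    have hpq : Measurable fun θ => p θ * q θ := hp.mul hq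
    have mean : ∀ {g : Θ → ENNReal}, Measurable g → _ := fun {g} hg =>
      hW.lintegral_mul_add le_rfl hZ hg (t - 1)
    rw [show 1 + (t - 1) = t by omega] at mean
    have ep := mean hp
    have eq := mean hq
    have epq := mean hpq
    have mp := hW.measurable_lintegral ht hp
    have mq := hW.measurable_lintegral ht hq
    have mpq := hW.measurable_lintegral ht hpq
    have mp1 := hW.measurable_lintegral le_rfl hp
    have mq1 := hW.measurable_lintegral le_rfl hq
    have mpq1 := hW.measurable_lintegral le_rfl hpq
    rw [hW.lintegral_mul_mul_succ ht (hZ.mono (past_mono W ht) le_rfl) hp hq,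
      hW.ofReal_lagRho_succ le_rfl ht, hW.ofReal_lagScale_succ le_rfl ht]
    exact lintegral_second_moment_step hZm mp mq mpq mp1 mq1 mpq1 ep eq epq ih

end Moments

/-! ### Real-valued means, conditional means and the lag covariance -/

section RealMoments

/-- Neither variable is assumed square-integrable; integrability of the product suffices to expand.
-/
theorem covariance_eq_integral_mul_sub {Ω : Type*} [MeasurableSpace Ω] {P : Measure Ω}
    [IsProbabilityMeasure P] {X Y : Ω → ℝ} (hX : Integrable X P) (hY : Integrable Y P)
    (hXY : Integrable (fun ω => X ω * Y ω) P) :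
    covariance X Y P = ∫ ω, X ω * Y ω ∂P - (∫ ω, X ω ∂P) * ∫ ω, Y ω ∂P := by
  rw [covariance]
  have e : ∀ ω, (X ω - ∫ ω, X ω ∂P) * (Y ω - ∫ ω, Y ω ∂P) = X ω * Y ω -
      (∫ ω, Y ω ∂P) * X ω - (∫ ω, X ω ∂P) * Y ω + (∫ ω, X ω ∂P) * ∫ ω, Y ω ∂P := fun ω => by ring
  have i1 := hX.const_mul (∫ ω, Y ω ∂P)
  have i2 := hY.const_mul (∫ ω, X ω ∂P)
  have i3 : Integrable (fun ω => X ω * Y ω - (∫ ω, Y ω ∂P) * X ω) P := hXY.sub i1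
  have i4 : Integrable (fun ω => X ω * Y ω - (∫ ω, Y ω ∂P) * X ω - (∫ ω, X ω ∂P) * Y ω) P :=
    i3.sub i2
  simp_rw [e]
  rw [integral_add i4 (integrable_const _), integral_sub i3 i2, integral_sub hXY i1,
    integral_const_mul, integral_const_mul, integral_const]
  simp
  ring

variable {Ω Θ : Type*} [mΩ : MeasurableSpace Ω] [MetricSpace Θ] [MeasurableSpace Θ]
  {P : Measure Ω} {H : Measure Θ} {β c : ℕ → ℝ} {W : ℕ → Ω → Measure Θ}

theorem IsMARG.lintegral_meanMeasure (hW : IsMARG P H β c W) {g : Θ → ENNReal}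
    (hg : Measurable g) :
    ∫⁻ θ, g θ ∂(meanMeasure P (W 1)) = ∫⁻ ω, ∫⁻ θ, g θ ∂(W 1 ω) ∂P :=
  Measure.lintegral_bind (hW.measurable 1 le_rfl).aemeasurable hg.aemeasurable

theorem integ_nonneg {Ω Θ : Type*} [MeasurableSpace Θ] (X : Ω → Measure Θ) {g : Θ → ℝ}
    (hg0 : ∀ θ, 0 ≤ g θ) (ω : Ω) : 0 ≤ integ X g ω := integral_nonneg hg0

theorem eq_pos_part_sub_neg_part {α : Type*} (g : α → ℝ) :
    g = fun θ => max (g θ) 0 - max (-g θ) 0 :=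
  funext fun θ => (max_zero_sub_max_neg_zero_eq_self (g θ)).symm

theorem measurable_past_integ {Ω Θ : Type*} [MeasurableSpace Θ] (W : ℕ → Ω → Measure Θ)
    {s t : ℕ} (hs : 1 ≤ s) (hst : s ≤ t) {g : Θ → ℝ} (hg : Measurable g) :
    Measurable[past W t] (integ (W s) g) :=
  (measurable_integral_measure hg).comp (measurable_past W hs hst)

theorem IsMARG.measurable_integ (hW : IsMARG P H β c W) {t : ℕ} (ht : 1 ≤ t) {g : Θ → ℝ}
    (hg : Measurable g) : Measurable (integ (W t) g) :=
  hW.measurable_integral ht hg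

variable [OpensMeasurableSpace Θ] [IsProbabilityMeasure P]

theorem IsMARG.lintegral_lintegral (hW : IsMARG P H β c W) {t : ℕ} (ht : 1 ≤ t)
    {g : Θ → ENNReal} (hg : Measurable g) :
    ∫⁻ ω, ∫⁻ θ, g θ ∂(W t ω) ∂P = ENNReal.ofReal (lagScale β c t 1) * ∫⁻ θ, g θ ∂H +
      ENNReal.ofReal (lagRho β c t 1) * ∫⁻ θ, g θ ∂(meanMeasure P (W 1)) := by
  have h := hW.lintegral_mul_add le_rfl (Z := 1) measurable_const hg (t - 1)
  rw [show 1 + (t - 1) = t by omega] at h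
  simp only [Pi.one_apply, one_mul] at h
  rw [h, lintegral_add_left measurable_const,
    lintegral_const_mul _ (hW.measurable_lintegral le_rfl hg), hW.lintegral_meanMeasure hg]
  simp

/-- The nonnegative mean identity applied to |g|. It gives both the almost sure integrability of `g`
and the integrability of `W_t(g)`. -/
theorem IsMARG.lintegral_lintegral_enorm_lt_top (hW : IsMARG P H β c W) {t : ℕ} (ht : 1 ≤ t)
    {g : Θ → ℝ} (hg : Measurable g) (hH : Integrable g H)
    (hM : Integrable g (meanMeasure P (W 1))) : ∫⁻ ω, ∫⁻ θ, ‖g θ‖ₑ ∂(W t ω) ∂P < ⊤ := by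
  rw [hW.lintegral_lintegral ht hg.enorm]
  exact ENNReal.add_lt_top.2 ⟨ENNReal.mul_lt_top ENNReal.ofReal_lt_top hH.2,
    ENNReal.mul_lt_top ENNReal.ofReal_lt_top hM.2⟩

theorem IsMARG.ae_integrable (hW : IsMARG P H β c W) {t : ℕ} (ht : 1 ≤ t)
    {g : Θ → ℝ} (hg : Measurable g) (hH : Integrable g H)
    (hM : Integrable g (meanMeasure P (W 1))) : ∀ᵐ ω ∂P, Integrable g (W t ω) := by
  filter_upwards [ae_lt_top (hW.measurable_lintegral ht hg.enorm)
    (hW.lintegral_lintegral_enorm_lt_top ht hg hH hM).ne] with ω hω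
  exact ⟨hg.aestronglyMeasurable, hω⟩

theorem IsMARG.integrable_integ (hW : IsMARG P H β c W) {t : ℕ} (ht : 1 ≤ t)
    {g : Θ → ℝ} (hg : Measurable g) (hH : Integrable g H)
    (hM : Integrable g (meanMeasure P (W 1))) : Integrable (integ (W t) g) P :=
  ⟨(hW.measurable_integ ht hg).aestronglyMeasurable,
    (lintegral_mono fun _ => enorm_integral_le_lintegral_enorm _).trans_lt
      (hW.lintegral_lintegral_enorm_lt_top ht hg hH hM)⟩

theorem IsMARG.ae_ofReal_integ (hW : IsMARG P H β c W) {t : ℕ} (ht : 1 ≤ t)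
    {g : Θ → ℝ} (hg : Measurable g) (hg0 : ∀ θ, 0 ≤ g θ) (hH : Integrable g H)
    (hM : Integrable g (meanMeasure P (W 1))) :
    ∀ᵐ ω ∂P, ENNReal.ofReal (integ (W t) g ω) = ∫⁻ θ, ENNReal.ofReal (g θ) ∂(W t ω) := by
  filter_upwards [hW.ae_integrable ht hg hH hM] with ω hω
  exact ofReal_integral_eq_lintegral_ofReal hω (ae_of_all _ hg0)

theorem IsMARG.setIntegral_integ_add_of_nonneg (hW : IsMARG P H β c W) {t : ℕ} (ht : 1 ≤ t)
    (h : ℕ) {g : Θ → ℝ} (hg : Measurable g) (hg0 : ∀ θ, 0 ≤ g θ) (hH : Integrable g H)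
    (hM : Integrable g (meanMeasure P (W 1))) {A : Set Ω} (hA : MeasurableSet[past W t] A) :
    ∫ ω in A, integ (W (t + h)) g ω ∂P = ∫ ω in A, lagScale β c (t + h) t * ∫ θ, g θ ∂H +
      lagRho β c (t + h) t * integ (W t) g ω ∂P := by
  have hAm := hW.past_le t A hA
  have hC : 0 ≤ lagScale β c (t + h) t := hW.lagScale_nonneg ht
  have hR : 0 ≤ lagRho β c (t + h) t := hW.lagRho_nonneg ht
  have hI : 0 ≤ ∫ θ, g θ ∂H := integral_nonneg hg0
  have hX := integ_nonneg (W t) hg0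
  have hm := hW.measurable_integ ht hg
  have hm' := hW.measurable_integ (t := t + h) (by omega) hg
  rw [integral_eq_lintegral_of_nonneg_ae (ae_of_all _ (integ_nonneg _ hg0))
      hm'.aestronglyMeasurable,
    integral_eq_lintegral_of_nonneg_ae (ae_of_all _ fun ω => by
      have := hX ω; simp only [Pi.zero_apply]; positivity) (by fun_prop)]
  congr 1
  -- An indicator weight turns the weighted identity into one over the event `A`, which is the form
  -- that characterizes a conditional expectation.
  have e := hW.lintegral_mul_add ht (Z := A.indicator 1) (measurable_const.indicator hA)
    hg.ennreal_ofReal h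
  rw [lintegral_indicator_one_mul hAm, lintegral_indicator_one_mul hAm] at e
  calc _ = _ := setLIntegral_congr_fun_ae hAm ?_
    _ = _ := e
    _ = _ := setLIntegral_congr_fun_ae hAm ?_
  · filter_upwards [hW.ae_ofReal_integ (t := t + h) (by omega) hg hg0 hH hM] with ω hω _
    exact hω
  · filter_upwards [hW.ae_ofReal_integ ht hg hg0 hH hM] with ω hω _
    rw [ENNReal.ofReal_add (mul_nonneg hC hI) (mul_nonneg hR (hX ω)), ENNReal.ofReal_mul hC,
      ENNReal.ofReal_mul hR, hω, ofReal_integral_eq_lintegral_ofReal hH (ae_of_all _ hg0)]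

theorem IsMARG.ae_integ_sub (hW : IsMARG P H β c W) {t : ℕ} (ht : 1 ≤ t) {p n : Θ → ℝ}
    (hp : Measurable p) (hpH : Integrable p H) (hpM : Integrable p (meanMeasure P (W 1)))
    (hn : Measurable n) (hnH : Integrable n H) (hnM : Integrable n (meanMeasure P (W 1))) :
    ∀ᵐ ω ∂P, integ (W t) (fun θ => p θ - n θ) ω = integ (W t) p ω - integ (W t) n ω := by
  filter_upwards [hW.ae_integrable ht hp hpH hpM, hW.ae_integrable ht hn hnH hnM] with ω h1 h2
  exact integral_sub h1 h2

theorem IsMARG.setIntegral_integ_add (hW : IsMARG P H β c W) {t : ℕ} (ht : 1 ≤ t)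
    (h : ℕ) {g : Θ → ℝ} (hg : Measurable g) (hH : Integrable g H)
    (hM : Integrable g (meanMeasure P (W 1))) {A : Set Ω} (hA : MeasurableSet[past W t] A) :
    ∫ ω in A, integ (W (t + h)) g ω ∂P = ∫ ω in A, lagScale β c (t + h) t * ∫ θ, g θ ∂H +
      lagRho β c (t + h) t * integ (W t) g ω ∂P := by
  have hp : Measurable fun θ => max (g θ) 0 := hg.max measurable_const
  have hn : Measurable fun θ => max (-g θ) 0 := hg.neg.max measurable_const
  have hpH := hH.pos_part
  have hpM := hM.pos_part
  have hnH := hH.neg_part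
  have hnM := hM.neg_part
  have e := eq_pos_part_sub_neg_part g
  have e1 := hW.setIntegral_integ_add_of_nonneg ht h hp (fun _ => le_max_right _ _) hpH hpM hA
  have e2 := hW.setIntegral_integ_add_of_nonneg ht h hn (fun _ => le_max_right _ _) hnH hnM hA
  have ip := (hW.integrable_integ ht hp hpH hpM).integrableOn (s := A)
  have in' := (hW.integrable_integ ht hn hnH hnM).integrableOn (s := A)
  have ip' := (hW.integrable_integ (t := t + h) (by omega) hp hpH hpM).integrableOn (s := A)
  have in'' := (hW.integrable_integ (t := t + h) (by omega) hn hnH hnM).integrableOn (s := A)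
  have k : ∀ r : ℝ, IntegrableOn (fun _ : Ω => r) A P := fun r => integrable_const r
  calc _ = ∫ ω in A, integ (W (t + h)) (fun θ => max (g θ) 0) ω -
        integ (W (t + h)) (fun θ => max (-g θ) 0) ω ∂P := by
        refine integral_congr_ae (ae_restrict_of_ae ?_)
        have := hW.ae_integ_sub (t := t + h) (by omega) hp hpH hpM hn hnH hnM
        rwa [← e] at this
    _ = _ := by
        rw [integral_sub ip' in'', e1, e2]
        refine (integral_sub ((k _).add (ip.const_mul _)) ((k _).add (in'.const_mul _))).symm.trans ?_
        refine integral_congr_ae (ae_restrict_of_ae ?_)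
        have h1 := hW.ae_integ_sub ht hp hpH hpM hn hnH hnM
        rw [← e] at h1
        have h2 : ∫ θ, g θ ∂H = ∫ θ, max (g θ) 0 ∂H - ∫ θ, max (-g θ) 0 ∂H := by
          rw [← integral_sub hpH hnH, ← e]
        filter_upwards [h1] with ω hω
        simp only [Pi.add_apply]
        rw [hω, h2]; ring

/-- Conditional mean of `W_{t+h}(g)` given the past up to time `t`. -/
theorem IsMARG.condExp_integ (hW : IsMARG P H β c W) {t : ℕ} (ht : 1 ≤ t)
    (h : ℕ) {g : Θ → ℝ} (hg : Measurable g) (hH : Integrable g H)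
    (hM : Integrable g (meanMeasure P (W 1))) :
    P[integ (W (t + h)) g | past W t] =ᵐ[P] fun ω => lagScale β c (t + h) t * ∫ θ, g θ ∂H +
      lagRho β c (t + h) t * integ (W t) g ω := by
  have hi : Integrable (fun ω => lagScale β c (t + h) t * ∫ θ, g θ ∂H +
      lagRho β c (t + h) t * integ (W t) g ω) P :=
    (integrable_const _).add ((hW.integrable_integ ht hg hH hM).const_mul _)
  refine (ae_eq_condExp_of_forall_setIntegral_eq (hW.past_le t)
    (hW.integrable_integ (by omega) hg hH hM) (fun A _ _ => hi.integrableOn)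
    (fun A hA _ => (hW.setIntegral_integ_add ht h hg hH hM hA).symm) ?_).symm
  exact (((measurable_past_integ W ht le_rfl hg).const_mul _).const_add
    _).stronglyMeasurable.aestronglyMeasurable

theorem IsMARG.integral_integ_one (hW : IsMARG P H β c W) {g : Θ → ℝ} (hg : Measurable g)
    (hH : Integrable g H) (hM : Integrable g (meanMeasure P (W 1))) :
    ∫ ω, integ (W 1) g ω ∂P = ∫ θ, g θ ∂(meanMeasure P (W 1)) := by
  have hp : Measurable fun ω => ∫⁻ θ, ENNReal.ofReal (g θ) ∂(W 1 ω) :=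
    hW.measurable_lintegral le_rfl hg.ennreal_ofReal
  have hn : Measurable fun ω => ∫⁻ θ, ENNReal.ofReal (-g θ) ∂(W 1 ω) :=
    hW.measurable_lintegral le_rfl hg.neg.ennreal_ofReal
  have en : ∫⁻ θ, ENNReal.ofReal (-g θ) ∂(meanMeasure P (W 1)) =
      ∫⁻ ω, ∫⁻ θ, ENNReal.ofReal (-g θ) ∂(W 1 ω) ∂P :=
    hW.lintegral_meanMeasure hg.neg.ennreal_ofReal
  have hfp : ∫⁻ ω, ∫⁻ θ, ENNReal.ofReal (g θ) ∂(W 1 ω) ∂P ≠ ⊤ := by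
    rw [← hW.lintegral_meanMeasure hg.ennreal_ofReal]
    exact hM.lintegral_lt_top.ne
  have hfn : ∫⁻ ω, ∫⁻ θ, ENNReal.ofReal (-g θ) ∂(W 1 ω) ∂P ≠ ⊤ := by
    rw [← en]
    exact hM.neg.lintegral_lt_top.ne
  rw [integral_eq_lintegral_pos_part_sub_lintegral_neg_part hM,
    hW.lintegral_meanMeasure hg.ennreal_ofReal, en,
    ← integral_toReal hp.aemeasurable (ae_lt_top hp hfp),
    ← integral_toReal hn.aemeasurable (ae_lt_top hn hfn),
    ← integral_sub (integrable_toReal_of_lintegral_ne_top hp.aemeasurable hfp)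
      (integrable_toReal_of_lintegral_ne_top hn.aemeasurable hfn)]
  refine integral_congr_ae ?_
  filter_upwards [hW.ae_integrable le_rfl hg hH hM] with ω hω
  exact integral_eq_lintegral_pos_part_sub_lintegral_neg_part hω

theorem IsMARG.integral_integ (hW : IsMARG P H β c W) {t : ℕ} (ht : 1 ≤ t)
    {g : Θ → ℝ} (hg : Measurable g) (hH : Integrable g H)
    (hM : Integrable g (meanMeasure P (W 1))) :
    ∫ ω, integ (W t) g ω ∂P = lagScale β c t 1 * ∫ θ, g θ ∂H +
      lagRho β c t 1 * ∫ θ, g θ ∂(meanMeasure P (W 1)) := by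
  have e := hW.setIntegral_integ_add le_rfl (t - 1) hg hH hM MeasurableSet.univ
  rw [show 1 + (t - 1) = t by omega, setIntegral_univ, setIntegral_univ,
    integral_add (integrable_const _) ((hW.integrable_integ le_rfl hg hH hM).const_mul _),
    integral_const_mul (lagRho β c t 1), hW.integral_integ_one hg hH hM] at e
  simpa using e

/-- The conditional mean of `W_{t+h}(g₂)` is a constant plus `lagRho` times `W_t(g₂)`. The constant
cancels in the covariance and the slope remains. -/
theorem IsMARG.covariance_integ_add (hW : IsMARG P H β c W) {t : ℕ} (ht : 1 ≤ t) (h : ℕ)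
    {g₁ g₂ : Θ → ℝ} (hg₁ : Measurable g₁) (hg₂ : Measurable g₂)
    (hH₁ : Integrable g₁ H) (hH₂ : Integrable g₂ H)
    (hM₁ : Integrable g₁ (meanMeasure P (W 1))) (hM₂ : Integrable g₂ (meanMeasure P (W 1)))
    (h₀ : Integrable (fun ω => integ (W t) g₁ ω * integ (W t) g₂ ω) P)
    (h₁ : Integrable (fun ω => integ (W t) g₁ ω * integ (W (t + h)) g₂ ω) P) :
    covariance (integ (W t) g₁) (integ (W (t + h)) g₂) P =
      lagRho β c (t + h) t * covariance (integ (W t) g₁) (integ (W t) g₂) P := by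
  have i1 := hW.integrable_integ ht hg₁ hH₁ hM₁
  have i2 := hW.integrable_integ ht hg₂ hH₂ hM₂
  have i3 := hW.integrable_integ (t := t + h) (by omega) hg₂ hH₂ hM₂
  have ce := hW.condExp_integ ht h hg₂ hH₂ hM₂
  have e1 : ∫ ω, integ (W (t + h)) g₂ ω ∂P = lagScale β c (t + h) t * ∫ θ, g₂ θ ∂H +
      lagRho β c (t + h) t * ∫ ω, integ (W t) g₂ ω ∂P := by
    rw [← integral_condExp (hW.past_le t), integral_congr_ae ce,
      integral_add (integrable_const _) (i2.const_mul _),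
      integral_const_mul (lagRho β c (t + h) t)]
    simp
  have e2 : ∫ ω, integ (W t) g₁ ω * integ (W (t + h)) g₂ ω ∂P =
      lagScale β c (t + h) t * (∫ θ, g₂ θ ∂H) * ∫ ω, integ (W t) g₁ ω ∂P +
      lagRho β c (t + h) t * ∫ ω, integ (W t) g₁ ω * integ (W t) g₂ ω ∂P := by
    -- Pulling `W_t(g₁)` out needs the lagged product to be integrable; splitting the resulting
    -- integral below needs the product at time `t`.
    have pull := condExp_mul_of_stronglyMeasurable_left (μ := P)
      (measurable_past_integ W ht le_rfl hg₁).stronglyMeasurable h₁ i3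
    have : ∀ᵐ ω ∂P, (P[fun ω => integ (W t) g₁ ω * integ (W (t + h)) g₂ ω | past W t]) ω =
        lagScale β c (t + h) t * (∫ θ, g₂ θ ∂H) * integ (W t) g₁ ω +
        lagRho β c (t + h) t * (integ (W t) g₁ ω * integ (W t) g₂ ω) := by
      filter_upwards [pull, ce] with ω h1 h2
      refine h1.trans ?_
      rw [Pi.mul_apply, h2]; ring
    rw [← integral_condExp (hW.past_le t), integral_congr_ae this,
      integral_add (i1.const_mul _) (h₀.const_mul _), integral_const_mul, integral_const_mul]
  rw [covariance_eq_integral_mul_sub i1 i3 h₁, covariance_eq_integral_mul_sub i1 i2 h₀, e1, e2]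
  ring

end RealMoments

/-! ### Second moments of nonnegative functions, localized to events of σ(W_1) -/

section SecondMoments

variable {Ω Θ : Type*} [mΩ : MeasurableSpace Ω] [MetricSpace Θ] [MeasurableSpace Θ]
  {P : Measure Ω} {H : Measure Θ} {β c : ℕ → ℝ} {W : ℕ → Ω → Measure Θ}

/-- The conditional second moment of `W_t` given `W_1`, evaluated at `(p, q)`. -/
noncomputable def condMoment (H : Measure Θ) (X : Ω → Measure Θ) (C R : ℝ) (p q : Θ → ℝ)
    (ω : Ω) : ℝ :=
  (C * ∫ θ, p θ ∂H + R * integ X p ω) * (C * ∫ θ, q θ ∂H + R * integ X q ω) +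
    (C ^ 2 * ∫ θ, p θ * q θ ∂H + 2 * C * R * integ X (fun θ => p θ * q θ) ω)

variable [OpensMeasurableSpace Θ] [IsProbabilityMeasure P]

/-- Over `A`, the second moment at time `t` is a finite combination of the quantities assumed
finite. -/
theorem IsMARG.lintegral_mul_lt_top (hW : IsMARG P H β c W) {t : ℕ} (ht : 1 ≤ t)
    {p q : Θ → ENNReal} (hp : Measurable p) (hq : Measurable q)
    (hpH : ∫⁻ θ, p θ ∂H < ⊤) (hqH : ∫⁻ θ, q θ ∂H < ⊤) (hpqH : ∫⁻ θ, p θ * q θ ∂H < ⊤)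
    (hpM : ∫⁻ ω, ∫⁻ θ, p θ ∂(W 1 ω) ∂P < ⊤) (hqM : ∫⁻ ω, ∫⁻ θ, q θ ∂(W 1 ω) ∂P < ⊤)
    (hpqM : ∫⁻ ω, ∫⁻ θ, p θ * q θ ∂(W 1 ω) ∂P < ⊤) {A : Set Ω} (hA : MeasurableSet[past W 1] A)
    (hM : ∫⁻ ω in A, (∫⁻ θ, p θ ∂(W 1 ω)) * ∫⁻ θ, q θ ∂(W 1 ω) ∂P < ⊤) :
    ∫⁻ ω in A, (∫⁻ θ, p θ ∂(W t ω)) * ∫⁻ θ, q θ ∂(W t ω) ∂P < ⊤ := by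
  have hAm := hW.past_le 1 A hA
  have e := hW.lintegral_mul_mul ht (Z := A.indicator 1) (measurable_const.indicator hA) hp hq
  rw [lintegral_indicator_one_mul hAm, lintegral_indicator_one_mul hAm] at e
  rw [e]
  have mp := hW.measurable_lintegral le_rfl hp
  have mq := hW.measurable_lintegral le_rfl hq
  have mpq : Measurable fun ω => ∫⁻ θ, p θ * q θ ∂(W 1 ω) :=
    hW.measurable_lintegral le_rfl (hp.mul hq)
  have hpM' := (setLIntegral_le_lintegral A _).trans_lt hpM
  have hqM' := (setLIntegral_le_lintegral A _).trans_lt hqM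
  have hpqM' := (setLIntegral_le_lintegral A _).trans_lt hpqM
  have hC : ENNReal.ofReal (lagScale β c t 1) < ⊤ := ENNReal.ofReal_lt_top
  have hR : ENNReal.ofReal (lagRho β c t 1) < ⊤ := ENNReal.ofReal_lt_top
  generalize ENNReal.ofReal (lagScale β c t 1) = C at *
  generalize ENNReal.ofReal (lagRho β c t 1) = R at *
  set u := ∫⁻ θ, p θ ∂H
  set v := ∫⁻ θ, q θ ∂H
  set w := ∫⁻ θ, p θ * q θ ∂H
  have mm : Measurable fun ω => (∫⁻ θ, p θ ∂(W 1 ω)) * ∫⁻ θ, q θ ∂(W 1 ω) := mp.mul mq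
  calc _ = ∫⁻ ω in A, C ^ 2 * (u * v + w) + (R * C * v * (∫⁻ θ, p θ ∂(W 1 ω)) +
        (R * C * u * (∫⁻ θ, q θ ∂(W 1 ω)) + (2 * C * R * (∫⁻ θ, p θ * q θ ∂(W 1 ω)) +
          R ^ 2 * ((∫⁻ θ, p θ ∂(W 1 ω)) * ∫⁻ θ, q θ ∂(W 1 ω))))) ∂P :=
        lintegral_congr fun ω => by ring
    _ < ⊤ := by
      rw [lintegral_add_left measurable_const, lintegral_add_left (mp.const_mul _),
        lintegral_add_left (mq.const_mul _), lintegral_add_left (mpq.const_mul _),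
        lintegral_const_mul _ mp, lintegral_const_mul _ mq, lintegral_const_mul _ mpq,
        lintegral_const_mul _ mm, setLIntegral_const]
      have hPA := measure_lt_top P A
      simp only [ENNReal.add_lt_top]
      refine ⟨?_, ?_, ?_, ?_, ?_⟩ <;>
      simp [ENNReal.mul_lt_top_iff, ENNReal.add_lt_top, *]

/-- Passes from [0, ∞] to real values: for nonnegative functions the two kinds of integral agree
almost surely. The event `A` is kept so that the result can be used after truncating `W 1`. -/
theorem IsMARG.integrableOn_mul_of_nonneg (hW : IsMARG P H β c W) {t : ℕ} (ht : 1 ≤ t)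
    {p q : Θ → ℝ} (hp : Measurable p) (hq : Measurable q) (hp0 : ∀ θ, 0 ≤ p θ)
    (hq0 : ∀ θ, 0 ≤ q θ) (hpH : Integrable p H) (hqH : Integrable q H)
    (hpqH : Integrable (fun θ => p θ * q θ) H)
    (hpM : Integrable p (meanMeasure P (W 1))) (hqM : Integrable q (meanMeasure P (W 1)))
    (hpqM : Integrable (fun θ => p θ * q θ) (meanMeasure P (W 1)))
    {A : Set Ω} (hA : MeasurableSet[past W 1] A)
    (hM : IntegrableOn (fun ω => integ (W 1) p ω * integ (W 1) q ω) A P) :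
    IntegrableOn (fun ω => integ (W t) p ω * integ (W t) q ω) A P ∧
    ∫ ω in A, integ (W t) p ω * integ (W t) q ω ∂P =
      ∫ ω in A, condMoment H (W 1) (lagScale β c t 1) (lagRho β c t 1) p q ω ∂P := by
  have hAm := hW.past_le 1 A hA
  have hpq : Measurable fun θ => p θ * q θ := hp.mul hq
  have hpq0 : ∀ θ, 0 ≤ p θ * q θ := fun θ => mul_nonneg (hp0 θ) (hq0 θ)
  have hC : 0 ≤ lagScale β c t 1 := hW.lagScale_nonneg le_rfl
  have hR : 0 ≤ lagRho β c t 1 := hW.lagRho_nonneg le_rfl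
  have hae : ∀ s, 1 ≤ s → ∀ᵐ ω ∂P, ω ∈ A → ENNReal.ofReal (integ (W s) p ω * integ (W s) q ω) =
      (∫⁻ θ, ENNReal.ofReal (p θ) ∂(W s ω)) * ∫⁻ θ, ENNReal.ofReal (q θ) ∂(W s ω) := by
    intro s hs
    filter_upwards [hW.ae_ofReal_integ hs hp hp0 hpH hpM, hW.ae_ofReal_integ hs hq hq0 hqH hqM]
      with ω h1 h2 _
    rw [ENNReal.ofReal_mul (integ_nonneg _ hp0 ω), h1, h2]
  have hnn : ∀ s ω, 0 ≤ integ (W s) p ω * integ (W s) q ω := fun s ω =>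
    mul_nonneg (integ_nonneg _ hp0 ω) (integ_nonneg _ hq0 ω)
  have hm : Measurable fun ω => integ (W t) p ω * integ (W t) q ω :=
    (hW.measurable_integ ht hp).mul (hW.measurable_integ ht hq)
  have hfin : ∀ {g : Θ → ℝ}, Measurable g → Integrable g (meanMeasure P (W 1)) →
      ∫⁻ ω, ∫⁻ θ, ENNReal.ofReal (g θ) ∂(W 1 ω) ∂P < ⊤ := fun hg hi => by
    rw [← hW.lintegral_meanMeasure hg.ennreal_ofReal]
    exact hi.lintegral_lt_top
  have l2 := hfin hpq hpqM
  have l1 := hpqH.lintegral_lt_top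
  have l3 := hM.lintegral_lt_top
  rw [setLIntegral_congr_fun_ae hAm (hae 1 le_rfl)] at l3
  simp_rw [ENNReal.ofReal_mul (hp0 _)] at l1 l2
  have hlt := hW.lintegral_mul_lt_top ht hp.ennreal_ofReal hq.ennreal_ofReal hpH.lintegral_lt_top
    hqH.lintegral_lt_top l1 (hfin hp hpM) (hfin hq hqM) l2 hA l3
  have hcm0 : ∀ ω, 0 ≤ condMoment H (W 1) (lagScale β c t 1) (lagRho β c t 1) p q ω := by
    intro ω
    have := integ_nonneg (W 1) hp0 ω
    have := integ_nonneg (W 1) hq0 ω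
    have := integ_nonneg (W 1) hpq0 ω
    have : 0 ≤ ∫ θ, p θ ∂H := integral_nonneg hp0
    have : 0 ≤ ∫ θ, q θ ∂H := integral_nonneg hq0
    have : 0 ≤ ∫ θ, p θ * q θ ∂H := integral_nonneg hpq0
    rw [condMoment]
    positivity
  have hcm : Measurable (condMoment H (W 1) (lagScale β c t 1) (lagRho β c t 1) p q) := by
    have := hW.measurable_integ le_rfl hp
    have := hW.measurable_integ le_rfl hq
    have := hW.measurable_integ le_rfl hpq
    unfold condMoment
    fun_prop
  refine ⟨⟨hm.aestronglyMeasurable, ?_⟩, ?_⟩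
  · rw [hasFiniteIntegral_iff_ofReal (ae_of_all _ (hnn t)),
      setLIntegral_congr_fun_ae hAm (hae t ht)]
    exact hlt
  · rw [integral_eq_lintegral_of_nonneg_ae (ae_of_all _ (hnn t)) hm.aestronglyMeasurable,
      integral_eq_lintegral_of_nonneg_ae (ae_of_all _ hcm0) hcm.aestronglyMeasurable,
      setLIntegral_congr_fun_ae hAm (hae t ht)]
    congr 1
    have e := hW.lintegral_mul_mul ht (Z := A.indicator 1) (measurable_const.indicator hA)
      hp.ennreal_ofReal hq.ennreal_ofReal
    rw [lintegral_indicator_one_mul hAm, lintegral_indicator_one_mul hAm] at e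
    rw [e]
    refine (setLIntegral_congr_fun_ae hAm ?_).symm
    filter_upwards [hW.ae_ofReal_integ le_rfl hp hp0 hpH hpM,
      hW.ae_ofReal_integ le_rfl hq hq0 hqH hqM, hW.ae_ofReal_integ le_rfl hpq hpq0 hpqH hpqM]
      with ω h1 h2 h3 _
    have k1 := integ_nonneg (W 1) hp0 ω
    have k2 := integ_nonneg (W 1) hq0 ω
    have k3 := integ_nonneg (W 1) hpq0 ω
    have k4 : 0 ≤ ∫ θ, p θ ∂H := integral_nonneg hp0
    have k5 : 0 ≤ ∫ θ, q θ ∂H := integral_nonneg hq0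
    have k6 : 0 ≤ ∫ θ, p θ * q θ ∂H := integral_nonneg hpq0
    simp_rw [← ENNReal.ofReal_mul (hp0 _)]
    rw [← h1, ← h2, ← h3, ← ofReal_integral_eq_lintegral_ofReal hpH (ae_of_all _ hp0),
      ← ofReal_integral_eq_lintegral_ofReal hqH (ae_of_all _ hq0),
      ← ofReal_integral_eq_lintegral_ofReal hpqH (ae_of_all _ hpq0), condMoment,
      ENNReal.ofReal_add (by positivity) (by positivity), ENNReal.ofReal_mul (by positivity),
      ENNReal.ofReal_add (by positivity) (by positivity),
      ENNReal.ofReal_add (by positivity) (by positivity),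
      ENNReal.ofReal_add (by positivity) (by positivity), ENNReal.ofReal_mul hC,
      ENNReal.ofReal_mul hC, ENNReal.ofReal_mul hR, ENNReal.ofReal_mul hR,
      ENNReal.ofReal_mul (by positivity), ENNReal.ofReal_mul (by positivity),
      ENNReal.ofReal_mul (by positivity), ENNReal.ofReal_mul (by positivity),
      ENNReal.ofReal_pow hC, ENNReal.ofReal_ofNat]

/-- Expanded, `condMoment` involves `W 1` quadratically only through the signed product, so no bound
on absolute values is required. -/
theorem IsMARG.integrableOn_condMoment (hW : IsMARG P H β c W) (C R : ℝ)
    {p q : Θ → ℝ} (hp : Measurable p) (hq : Measurable q) (hpH : Integrable p H)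
    (hqH : Integrable q H) (hpqH : Integrable (fun θ => p θ * q θ) H)
    (hpM : Integrable p (meanMeasure P (W 1))) (hqM : Integrable q (meanMeasure P (W 1)))
    (hpqM : Integrable (fun θ => p θ * q θ) (meanMeasure P (W 1))) {A : Set Ω}
    (hM : IntegrableOn (fun ω => integ (W 1) p ω * integ (W 1) q ω) A P) :
    IntegrableOn (condMoment H (W 1) C R p q) A P := by
  have i1 := (hW.integrable_integ le_rfl hp hpH hpM).integrableOn (s := A)
  have i2 := (hW.integrable_integ le_rfl hq hqH hqM).integrableOn (s := A)
  have i3 := (hW.integrable_integ le_rfl (hp.mul hq) hpqH hpqM).integrableOn (s := A)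
  have e : condMoment H (W 1) C R p q = fun ω =>
      C ^ 2 * ((∫ θ, p θ ∂H) * (∫ θ, q θ ∂H) + ∫ θ, p θ * q θ ∂H) +
      (C * R * (∫ θ, q θ ∂H) * integ (W 1) p ω + (C * R * (∫ θ, p θ ∂H) * integ (W 1) q ω +
        (2 * C * R * integ (W 1) (fun θ => p θ * q θ) ω +
          R ^ 2 * (integ (W 1) p ω * integ (W 1) q ω)))) := by
    funext ω; rw [condMoment]; ring
  rw [e]
  have k : ∀ r : ℝ, IntegrableOn (fun _ : Ω => r) A P := fun r => integrable_const r
  exact (k _).add ((i1.const_mul _).add ((i2.const_mul _).add ((i3.const_mul _).add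
    (hM.const_mul _))))

theorem IsMARG.integral_condMoment (hW : IsMARG P H β c W) (C R : ℝ)
    {p q : Θ → ℝ} (hp : Measurable p) (hq : Measurable q) (hpH : Integrable p H)
    (hqH : Integrable q H) (hpqH : Integrable (fun θ => p θ * q θ) H)
    (hpM : Integrable p (meanMeasure P (W 1))) (hqM : Integrable q (meanMeasure P (W 1)))
    (hpqM : Integrable (fun θ => p θ * q θ) (meanMeasure P (W 1)))
    (hM : Integrable (fun ω => integ (W 1) p ω * integ (W 1) q ω) P) :
    ∫ ω, condMoment H (W 1) C R p q ω ∂P =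
      C ^ 2 * ((∫ θ, p θ ∂H) * (∫ θ, q θ ∂H) + ∫ θ, p θ * q θ ∂H) +
      (C * R * (∫ θ, q θ ∂H) * (∫ θ, p θ ∂(meanMeasure P (W 1))) +
        (C * R * (∫ θ, p θ ∂H) * (∫ θ, q θ ∂(meanMeasure P (W 1))) +
        (2 * C * R * (∫ θ, p θ * q θ ∂(meanMeasure P (W 1))) +
          R ^ 2 * ∫ ω, integ (W 1) p ω * integ (W 1) q ω ∂P))) := by
  have i1 := hW.integrable_integ le_rfl hp hpH hpM
  have i2 := hW.integrable_integ le_rfl hq hqH hqM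
  have i3 : Integrable (integ (W 1) fun θ => p θ * q θ) P :=
    hW.integrable_integ le_rfl (hp.mul hq) hpqH hpqM
  have e : ∀ ω, condMoment H (W 1) C R p q ω =
      C ^ 2 * ((∫ θ, p θ ∂H) * (∫ θ, q θ ∂H) + ∫ θ, p θ * q θ ∂H) +
      (C * R * (∫ θ, q θ ∂H) * integ (W 1) p ω + (C * R * (∫ θ, p θ ∂H) * integ (W 1) q ω +
        (2 * C * R * integ (W 1) (fun θ => p θ * q θ) ω +
          R ^ 2 * (integ (W 1) p ω * integ (W 1) q ω)))) := by
    intro ω; rw [condMoment]; ring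
  simp_rw [e]
  have j4 := hM.const_mul (R ^ 2)
  have j3 := i3.const_mul (2 * C * R)
  have j2 := i2.const_mul (C * R * ∫ θ, p θ ∂H)
  have j1 := i1.const_mul (C * R * ∫ θ, q θ ∂H)
  rw [integral_add (integrable_const _) (j1.fun_add (j2.fun_add (j3.fun_add j4))), integral_const,
    probReal_univ, one_smul]
  congr 1
  rw [integral_add j1 (j2.fun_add (j3.fun_add j4)), integral_const_mul _ (integ (W 1) p),
    hW.integral_integ_one hp hpH hpM]
  congr 1
  rw [integral_add j2 (j3.fun_add j4), integral_const_mul _ (integ (W 1) q),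
    hW.integral_integ_one hq hqH hqM]
  congr 1
  rw [integral_add j3 j4, integral_const_mul _ (integ (W 1) _), integral_const_mul (R ^ 2),
    hW.integral_integ_one (g := fun θ => p θ * q θ) (hp.mul hq) hpqH hpqM]

end SecondMoments

/-! ### Signed functions: truncation, covariance and existence of product moments -/

section Signed

theorem integral_four_terms {α : Type*} [MeasurableSpace α] {μ : Measure α} {a b c d : α → ℝ}
    (ha : Integrable a μ) (hb : Integrable b μ) (hc : Integrable c μ) (hd : Integrable d μ) :
    ∫ x, (a x - b x - c x + d x) ∂μ =
      ∫ x, a x ∂μ - ∫ x, b x ∂μ - ∫ x, c x ∂μ + ∫ x, d x ∂μ := by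
  have h1 : Integrable (fun x => a x - b x) μ := ha.sub hb
  have h2 : Integrable (fun x => a x - b x - c x) μ := h1.sub hc
  rw [integral_add h2 hd, integral_sub h1 hc, integral_sub ha hb]

variable {Ω Θ : Type*} [mΩ : MeasurableSpace Ω] [MetricSpace Θ] [MeasurableSpace Θ]
  {P : Measure Ω} {H : Measure Θ} {β c : ℕ → ℝ} {W : ℕ → Ω → Measure Θ}
  [OpensMeasurableSpace Θ] [IsProbabilityMeasure P]

theorem IsMARG.integrableOn_mul_of_abs_le (hW : IsMARG P H β c W) {t : ℕ} (ht : 1 ≤ t)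
    {g₁ g₂ p q : Θ → ℝ} (hp : Measurable p) (hq : Measurable q)
    (hg₁ : Measurable g₁) (hg₂ : Measurable g₂)
    (hp1 : ∀ θ, |p θ| ≤ |g₁ θ|) (hq1 : ∀ θ, |q θ| ≤ |g₂ θ|)
    (hH₁ : Integrable g₁ H) (hH₂ : Integrable g₂ H)
    (hM₁ : Integrable g₁ (meanMeasure P (W 1))) (hM₂ : Integrable g₂ (meanMeasure P (W 1)))
    {A : Set Ω}
    (hA : IntegrableOn (fun ω => integ (W t) (fun θ => |g₁ θ|) ω *
      integ (W t) (fun θ => |g₂ θ|) ω) A P) :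
    IntegrableOn (fun ω => integ (W t) p ω * integ (W t) q ω) A P := by
  refine hA.mono' ((hW.measurable_integ ht hp).mul
    (hW.measurable_integ ht hq)).aestronglyMeasurable (ae_restrict_of_ae ?_)
  filter_upwards [hW.ae_integrable ht hg₁ hH₁ hM₁, hW.ae_integrable ht hg₂ hH₂ hM₂] with ω h1 h2
  rw [norm_mul]
  exact mul_le_mul (norm_integral_le_of_norm_le h1.abs (ae_of_all _ hp1))
    (norm_integral_le_of_norm_le h2.abs (ae_of_all _ hq1)) (norm_nonneg _)
    (integ_nonneg _ (fun _ => abs_nonneg _) _)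

/-- Both sides are bilinear in (g₁, g₂), so the nonnegative case is applied to the four pairs of
positive and negative parts. Integrability of the absolute product on `A` makes all four finite. -/
theorem IsMARG.setIntegral_integ_mul (hW : IsMARG P H β c W) {t : ℕ} (ht : 1 ≤ t)
    {g₁ g₂ : Θ → ℝ} (hg₁ : Measurable g₁) (hg₂ : Measurable g₂)
    (hH₁ : Integrable g₁ H) (hH₂ : Integrable g₂ H) (hH : Integrable (fun θ => g₁ θ * g₂ θ) H)
    (hM₁ : Integrable g₁ (meanMeasure P (W 1))) (hM₂ : Integrable g₂ (meanMeasure P (W 1)))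
    (hM : Integrable (fun θ => g₁ θ * g₂ θ) (meanMeasure P (W 1)))
    {A : Set Ω} (hA : MeasurableSet[past W 1] A)
    (hAi : IntegrableOn (fun ω => integ (W 1) (fun θ => |g₁ θ|) ω *
      integ (W 1) (fun θ => |g₂ θ|) ω) A P) :
    ∫ ω in A, integ (W t) g₁ ω * integ (W t) g₂ ω ∂P =
      ∫ ω in A, condMoment H (W 1) (lagScale β c t 1) (lagRho β c t 1) g₁ g₂ ω ∂P := by
  have part : ∀ {p q : Θ → ℝ}, Measurable p → Measurable q → (∀ θ, 0 ≤ p θ) → (∀ θ, 0 ≤ q θ) →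
      (∀ θ, |p θ| ≤ |g₁ θ|) → (∀ θ, |q θ| ≤ |g₂ θ|) →
      Integrable (fun θ => p θ * q θ) H ∧ (∀ᵐ ω ∂P, Integrable (fun θ => p θ * q θ) (W 1 ω)) ∧
      IntegrableOn (fun ω => integ (W t) p ω * integ (W t) q ω) A P ∧
      IntegrableOn (condMoment H (W 1) (lagScale β c t 1) (lagRho β c t 1) p q) A P ∧
      ∫ ω in A, integ (W t) p ω * integ (W t) q ω ∂P =
        ∫ ω in A, condMoment H (W 1) (lagScale β c t 1) (lagRho β c t 1) p q ω ∂P := by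
    intro p q hp hq hp0 hq0 hp1 hq1
    have ip : ∀ {ν : Measure Θ}, Integrable g₁ ν → Integrable p ν := fun h =>
      h.mono hp.aestronglyMeasurable (ae_of_all _ hp1)
    have iq : ∀ {ν : Measure Θ}, Integrable g₂ ν → Integrable q ν := fun h =>
      h.mono hq.aestronglyMeasurable (ae_of_all _ hq1)
    have ipq : ∀ {ν : Measure Θ}, Integrable (fun θ => g₁ θ * g₂ θ) ν →
        Integrable (fun θ => p θ * q θ) ν := fun h =>
      h.mono (hp.mul hq).aestronglyMeasurable (ae_of_all _ fun θ => by
        simp only [norm_mul]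
        exact mul_le_mul (hp1 θ) (hq1 θ) (norm_nonneg _) (norm_nonneg _))
    have i1 := hW.integrableOn_mul_of_abs_le le_rfl hp hq hg₁ hg₂ hp1 hq1 hH₁ hH₂ hM₁ hM₂ hAi
    have i2 := hW.integrableOn_mul_of_nonneg ht hp hq hp0 hq0 (ip hH₁) (iq hH₂) (ipq hH) (ip hM₁)
      (iq hM₂) (ipq hM) hA i1
    exact ⟨ipq hH, hW.ae_integrable le_rfl (hp.mul hq) (ipq hH) (ipq hM), i2.1,
      hW.integrableOn_condMoment _ _ hp hq (ip hH₁) (iq hH₂) (ipq hH) (ip hM₁) (iq hM₂)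
        (ipq hM) i1, i2.2⟩
  have parts : ∀ {g : Θ → ℝ}, Measurable g → ∃ p n : Θ → ℝ, Measurable p ∧ Measurable n ∧
      (∀ θ, 0 ≤ p θ) ∧ (∀ θ, 0 ≤ n θ) ∧ (∀ θ, |p θ| ≤ |g θ|) ∧ (∀ θ, |n θ| ≤ |g θ|) ∧
      g = fun θ => p θ - n θ := by
    intro g hg
    refine ⟨fun θ => max (g θ) 0, fun θ => max (-g θ) 0, hg.max measurable_const,
      hg.neg.max measurable_const, fun _ => le_max_right _ _, fun _ => le_max_right _ _,
      fun θ => ?_, fun θ => ?_, eq_pos_part_sub_neg_part g⟩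
    · rw [abs_of_nonneg (le_max_right _ _)]
      exact max_le (le_abs_self _) (abs_nonneg _)
    · rw [abs_of_nonneg (le_max_right _ _)]
      exact max_le (neg_le_abs _) (abs_nonneg _)
  obtain ⟨p₁, n₁, mp₁, mn₁, p₁0, n₁0, p₁g, n₁g, e₁⟩ := parts hg₁
  obtain ⟨p₂, n₂, mp₂, mn₂, p₂0, n₂0, p₂g, n₂g, e₂⟩ := parts hg₂
  obtain ⟨pp1, pp2, pp3, pp4, pp5⟩ := part mp₁ mp₂ p₁0 p₂0 p₁g p₂g
  obtain ⟨pn1, pn2, pn3, pn4, pn5⟩ := part mp₁ mn₂ p₁0 n₂0 p₁g n₂g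
  obtain ⟨np1, np2, np3, np4, np5⟩ := part mn₁ mp₂ n₁0 p₂0 n₁g p₂g
  obtain ⟨nn1, nn2, nn3, nn4, nn5⟩ := part mn₁ mn₂ n₁0 n₂0 n₁g n₂g
  have dom : ∀ {p g : Θ → ℝ} {ν : Measure Θ}, Measurable p → (∀ θ, |p θ| ≤ |g θ|) →
      Integrable g ν → Integrable p ν := fun hp h hg =>
    hg.mono hp.aestronglyMeasurable (ae_of_all _ h)
  have lin₁ : ∀ s, 1 ≤ s → ∀ᵐ ω ∂P, integ (W s) g₁ ω = integ (W s) p₁ ω - integ (W s) n₁ ω := by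
    intro s hs
    have := hW.ae_integ_sub hs mp₁ (dom mp₁ p₁g hH₁) (dom mp₁ p₁g hM₁) mn₁ (dom mn₁ n₁g hH₁)
      (dom mn₁ n₁g hM₁)
    rwa [← e₁] at this
  have lin₂ : ∀ s, 1 ≤ s → ∀ᵐ ω ∂P, integ (W s) g₂ ω = integ (W s) p₂ ω - integ (W s) n₂ ω := by
    intro s hs
    have := hW.ae_integ_sub hs mp₂ (dom mp₂ p₂g hH₂) (dom mp₂ p₂g hM₂) mn₂ (dom mn₂ n₂g hH₂)
      (dom mn₂ n₂g hM₂)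
    rwa [← e₂] at this
  have eH₁ : ∫ θ, g₁ θ ∂H = ∫ θ, p₁ θ ∂H - ∫ θ, n₁ θ ∂H := by
    rw [← integral_sub (dom mp₁ p₁g hH₁) (dom mn₁ n₁g hH₁), ← e₁]
  have eH₂ : ∫ θ, g₂ θ ∂H = ∫ θ, p₂ θ ∂H - ∫ θ, n₂ θ ∂H := by
    rw [← integral_sub (dom mp₂ p₂g hH₂) (dom mn₂ n₂g hH₂), ← e₂]
  have eprod : ∀ θ, g₁ θ * g₂ θ = p₁ θ * p₂ θ - p₁ θ * n₂ θ - n₁ θ * p₂ θ + n₁ θ * n₂ θ := by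
    intro θ
    rw [congrFun e₁ θ, congrFun e₂ θ]; ring
  have eH : ∫ θ, g₁ θ * g₂ θ ∂H = _ :=
    (integral_congr_ae (ae_of_all _ eprod)).trans (integral_four_terms pp1 pn1 np1 nn1)
  have hpt : ∀ᵐ ω ∂P, integ (W t) g₁ ω * integ (W t) g₂ ω =
      integ (W t) p₁ ω * integ (W t) p₂ ω - integ (W t) p₁ ω * integ (W t) n₂ ω -
        integ (W t) n₁ ω * integ (W t) p₂ ω + integ (W t) n₁ ω * integ (W t) n₂ ω := by
    filter_upwards [lin₁ t ht, lin₂ t ht] with ω h1 h2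
    rw [h1, h2]; ring
  have hL : ∫ ω in A, integ (W t) g₁ ω * integ (W t) g₂ ω ∂P = _ :=
    (integral_congr_ae (ae_restrict_of_ae hpt)).trans (integral_four_terms pp3 pn3 np3 nn3)
  rw [hL, pp5, pn5, np5, nn5, ← integral_four_terms pp4 pn4 np4 nn4]
  refine integral_congr_ae (ae_restrict_of_ae ?_)
  filter_upwards [lin₁ 1 le_rfl, lin₂ 1 le_rfl, pp2, pn2, np2, nn2] with ω h1 h2 k1 k2 k3 k4
  have k : integ (W 1) (fun θ => g₁ θ * g₂ θ) ω = integ (W 1) (fun θ => p₁ θ * p₂ θ) ω -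
      integ (W 1) (fun θ => p₁ θ * n₂ θ) ω - integ (W 1) (fun θ => n₁ θ * p₂ θ) ω +
      integ (W 1) (fun θ => n₁ θ * n₂ θ) ω :=
    (integral_congr_ae (ae_of_all _ eprod)).trans (integral_four_terms k1 k2 k3 k4)
  simp only [condMoment]
  rw [k, h1, h2, eH₁, eH₂, eH]
  ring

/-- The signed products may be integrable although the products of the positive and negative parts
are not, so a direct split is impossible. The identity is localized to events where the split is
legitimate; integrability of both sides then allows the passage to Ω. -/
theorem IsMARG.integral_integ_mul (hW : IsMARG P H β c W) {t : ℕ} (ht : 1 ≤ t)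
    {g₁ g₂ : Θ → ℝ} (hg₁ : Measurable g₁) (hg₂ : Measurable g₂)
    (hH₁ : Integrable g₁ H) (hH₂ : Integrable g₂ H) (hH : Integrable (fun θ => g₁ θ * g₂ θ) H)
    (hM₁ : Integrable g₁ (meanMeasure P (W 1))) (hM₂ : Integrable g₂ (meanMeasure P (W 1)))
    (hM : Integrable (fun θ => g₁ θ * g₂ θ) (meanMeasure P (W 1)))
    (h₁ : Integrable (fun ω => integ (W 1) g₁ ω * integ (W 1) g₂ ω) P)
    (h_t : Integrable (fun ω => integ (W t) g₁ ω * integ (W t) g₂ ω) P) :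
    ∫ ω, integ (W t) g₁ ω * integ (W t) g₂ ω ∂P =
      ∫ ω, condMoment H (W 1) (lagScale β c t 1) (lagRho β c t 1) g₁ g₂ ω ∂P := by
  -- These events lie in σ(W_1), and on `A N` the absolute product is at most N². They cover all of
  -- Ω because `integ` is always a real number, being 0 when the integral diverges.
  let A : ℕ → Set Ω := fun N => {ω | integ (W 1) (fun θ => |g₁ θ|) ω ≤ N} ∩
    {ω | integ (W 1) (fun θ => |g₂ θ|) ω ≤ N}
  have ma₁ : Measurable fun θ => |g₁ θ| := hg₁.abs
  have ma₂ : Measurable fun θ => |g₂ θ| := hg₂.abs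
  have hA : ∀ N, MeasurableSet[past W 1] (A N) := fun N =>
    @MeasurableSet.inter Ω (past W 1) _ _
      (@measurableSet_le _ _ _ _ _ (past W 1) _ _ _ _ _
        (measurable_past_integ W le_rfl le_rfl ma₁) measurable_const)
      (@measurableSet_le _ _ _ _ _ (past W 1) _ _ _ _ _
        (measurable_past_integ W le_rfl le_rfl ma₂) measurable_const)
  have hAm : ∀ N, MeasurableSet (A N) := fun N => hW.past_le 1 _ (hA N)
  have hmono : Monotone A := fun m n hmn ω hω => by
    have : (m : ℝ) ≤ n := by exact_mod_cast hmn
    exact ⟨hω.1.trans this, hω.2.trans this⟩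
  have hU : ⋃ N, A N = Set.univ := by
    refine Set.eq_univ_of_forall fun ω => ?_
    obtain ⟨N, hN⟩ := exists_nat_ge
      (max (integ (W 1) (fun θ => |g₁ θ|) ω) (integ (W 1) (fun θ => |g₂ θ|) ω))
    exact Set.mem_iUnion.2 ⟨N, (le_max_left _ _).trans hN, (le_max_right _ _).trans hN⟩
  have hcm : Integrable (condMoment H (W 1) (lagScale β c t 1) (lagRho β c t 1) g₁ g₂) P := by
    rw [← integrableOn_univ]
    exact hW.integrableOn_condMoment _ _ hg₁ hg₂ hH₁ hH₂ hH hM₁ hM₂ hM h₁.integrableOn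
  have lim : ∀ {F : Ω → ℝ}, Integrable F P →
      Tendsto (fun N => ∫ ω in A N, F ω ∂P) atTop (𝓝 (∫ ω, F ω ∂P)) := fun hF => by
    have := tendsto_setIntegral_of_monotone hAm hmono (hF.integrableOn (s := ⋃ N, A N))
    rwa [hU, setIntegral_univ] at this
  refine tendsto_nhds_unique (lim h_t) ((lim hcm).congr fun N => ?_)
  refine (hW.setIntegral_integ_mul ht hg₁ hg₂ hH₁ hH₂ hH hM₁ hM₂ hM (hA N) ?_).symm
  have a1 := integ_nonneg (W 1) (g := fun θ => |g₁ θ|) fun _ => abs_nonneg _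
  have a2 := integ_nonneg (W 1) (g := fun θ => |g₂ θ|) fun _ => abs_nonneg _
  refine Measure.integrableOn_of_bounded (M := N * N) (measure_ne_top P _)
    ((hW.measurable_integ le_rfl ma₁).mul (hW.measurable_integ le_rfl ma₂)).aestronglyMeasurable
    ((ae_restrict_iff' (hAm N)).2 (ae_of_all _ fun ω hω => ?_))
  rw [Real.norm_of_nonneg (mul_nonneg (a1 ω) (a2 ω))]
  exact mul_le_mul hω.1 hω.2 (a2 ω) (Nat.cast_nonneg N)

/-- Subtracting the product of the means removes from the integrated `condMoment` everything except
the two integrals of g₁g₂ and the covariance at time 1. -/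
theorem IsMARG.covariance_integ (hW : IsMARG P H β c W) {t : ℕ} (ht : 1 ≤ t)
    {g₁ g₂ : Θ → ℝ} (hg₁ : Measurable g₁) (hg₂ : Measurable g₂)
    (hH₁ : Integrable g₁ H) (hH₂ : Integrable g₂ H) (hH : Integrable (fun θ => g₁ θ * g₂ θ) H)
    (hM₁ : Integrable g₁ (meanMeasure P (W 1))) (hM₂ : Integrable g₂ (meanMeasure P (W 1)))
    (hM : Integrable (fun θ => g₁ θ * g₂ θ) (meanMeasure P (W 1)))
    (h₁ : Integrable (fun ω => integ (W 1) g₁ ω * integ (W 1) g₂ ω) P)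
    (h_t : Integrable (fun ω => integ (W t) g₁ ω * integ (W t) g₂ ω) P) :
    covariance (integ (W t) g₁) (integ (W t) g₂) P =
      lagScale β c t 1 ^ 2 * ∫ θ, g₁ θ * g₂ θ ∂H +
        2 * lagRho β c t 1 * lagScale β c t 1 * ∫ θ, g₁ θ * g₂ θ ∂(meanMeasure P (W 1)) +
        lagRho β c t 1 ^ 2 * covariance (integ (W 1) g₁) (integ (W 1) g₂) P := by
  have i : ∀ s, 1 ≤ s → ∀ {g : Θ → ℝ}, Measurable g → Integrable g H →
      Integrable g (meanMeasure P (W 1)) → Integrable (integ (W s) g) P :=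
    fun s hs _ hg h h' => hW.integrable_integ hs hg h h'
  rw [covariance_eq_integral_mul_sub (i t ht hg₁ hH₁ hM₁) (i t ht hg₂ hH₂ hM₂) h_t,
    covariance_eq_integral_mul_sub (i 1 le_rfl hg₁ hH₁ hM₁) (i 1 le_rfl hg₂ hH₂ hM₂) h₁,
    hW.integral_integ_mul ht hg₁ hg₂ hH₁ hH₂ hH hM₁ hM₂ hM h₁ h_t,
    hW.integral_condMoment _ _ hg₁ hg₂ hH₁ hH₂ hH hM₁ hM₂ hM h₁, hW.integral_integ ht hg₁ hH₁ hM₁,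
    hW.integral_integ ht hg₂ hH₂ hM₂, hW.integral_integ_one hg₁ hH₁ hM₁,
    hW.integral_integ_one hg₂ hH₂ hM₂]
  ring

/-- After absolute values are taken, the conditional mean identity with weight ∫ |g₁| dW_t brings
the time t + h back to t. What remains is a first and a second absolute moment at time t, both
finite. -/
theorem IsMARG.integrable_integ_mul_add (hW : IsMARG P H β c W) {t : ℕ} (ht : 1 ≤ t) (h : ℕ)
    {g₁ g₂ : Θ → ℝ} (hg₁ : Measurable g₁) (hg₂ : Measurable g₂)
    (hH₁ : Integrable g₁ H) (hH₂ : Integrable g₂ H) (hH : Integrable (fun θ => g₁ θ * g₂ θ) H)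
    (hM₁ : Integrable g₁ (meanMeasure P (W 1))) (hM₂ : Integrable g₂ (meanMeasure P (W 1)))
    (hM : Integrable (fun θ => g₁ θ * g₂ θ) (meanMeasure P (W 1)))
    (h₁ : Integrable (fun ω => integ (W 1) (fun θ => |g₁ θ|) ω *
      integ (W 1) (fun θ => |g₂ θ|) ω) P) :
    Integrable (fun ω => integ (W t) g₁ ω * integ (W (t + h)) g₂ ω) P := by
  have m1 := hW.measurable_lintegral ht hg₁.enorm
  have m2 := hW.measurable_lintegral ht hg₂.enorm
  have m12 : Measurable fun ω => (∫⁻ θ, ‖g₁ θ‖ₑ ∂(W t ω)) * ∫⁻ θ, ‖g₂ θ‖ₑ ∂(W t ω) := m1.mul m2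
  have mH : ∫⁻ θ, ‖g₁ θ‖ₑ * ‖g₂ θ‖ₑ ∂H < ⊤ := by
    have h2 : ∫⁻ θ, ‖g₁ θ * g₂ θ‖ₑ ∂H < ⊤ := hH.2
    simpa only [enorm_mul] using h2
  have mM : ∫⁻ ω, ∫⁻ θ, ‖g₁ θ‖ₑ * ‖g₂ θ‖ₑ ∂(W 1 ω) ∂P < ⊤ := by
    have := hW.lintegral_lintegral_enorm_lt_top le_rfl (hg₁.mul hg₂) hH hM
    simpa only [Pi.mul_apply, enorm_mul] using this
  have mW : ∫⁻ ω in Set.univ, (∫⁻ θ, ‖g₁ θ‖ₑ ∂(W 1 ω)) * ∫⁻ θ, ‖g₂ θ‖ₑ ∂(W 1 ω) ∂P < ⊤ := by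
    rw [Measure.restrict_univ]
    refine lt_of_eq_of_lt (lintegral_congr_ae ?_) h₁.lintegral_lt_top
    filter_upwards [hW.ae_integrable le_rfl hg₁ hH₁ hM₁, hW.ae_integrable le_rfl hg₂ hH₂ hM₂]
      with ω k1 k2
    rw [ENNReal.ofReal_mul (integ_nonneg _ (fun _ => abs_nonneg _) _)]
    congr 1
    · exact (ofReal_integral_norm_eq_lintegral_enorm k1).symm
    · exact (ofReal_integral_norm_eq_lintegral_enorm k2).symm
  have l0 := hW.lintegral_mul_lt_top ht hg₁.enorm hg₂.enorm hH₁.2 hH₂.2 mH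
    (hW.lintegral_lintegral_enorm_lt_top le_rfl hg₁ hH₁ hM₁)
    (hW.lintegral_lintegral_enorm_lt_top le_rfl hg₂ hH₂ hM₂) mM MeasurableSet.univ mW
  rw [Measure.restrict_univ] at l0
  have l1 := hW.lintegral_lintegral_enorm_lt_top ht hg₁ hH₁ hM₁
  have l2 : ∫⁻ θ, ‖g₂ θ‖ₑ ∂H < ⊤ := hH₂.2
  refine ⟨((hW.measurable_integ ht hg₁).mul
    (hW.measurable_integ (by omega) hg₂)).aestronglyMeasurable, ?_⟩
  calc ∫⁻ ω, ‖integ (W t) g₁ ω * integ (W (t + h)) g₂ ω‖ₑ ∂P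
      ≤ ∫⁻ ω, (∫⁻ θ, ‖g₁ θ‖ₑ ∂(W t ω)) * ∫⁻ θ, ‖g₂ θ‖ₑ ∂(W (t + h) ω) ∂P := by
        refine lintegral_mono fun ω => ?_
        rw [enorm_mul]
        exact mul_le_mul' (enorm_integral_le_lintegral_enorm _)
          (enorm_integral_le_lintegral_enorm _)
    _ = ∫⁻ ω, ENNReal.ofReal (lagScale β c (t + h) t) * (∫⁻ θ, ‖g₂ θ‖ₑ ∂H) *
          (∫⁻ θ, ‖g₁ θ‖ₑ ∂(W t ω)) + ENNReal.ofReal (lagRho β c (t + h) t) *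
          ((∫⁻ θ, ‖g₁ θ‖ₑ ∂(W t ω)) * ∫⁻ θ, ‖g₂ θ‖ₑ ∂(W t ω)) ∂P := by
        rw [hW.lintegral_mul_add ht (measurable_past_lintegral W ht le_rfl hg₁.enorm) hg₂.enorm h]
        exact lintegral_congr fun ω => by ring
    _ < ⊤ := by
        rw [lintegral_add_left (m1.const_mul _), lintegral_const_mul _ m1,
          lintegral_const_mul _ m12]
        exact ENNReal.add_lt_top.2 ⟨ENNReal.mul_lt_top
          (ENNReal.mul_lt_top ENNReal.ofReal_lt_top l2) l1,
          ENNReal.mul_lt_top ENNReal.ofReal_lt_top l0⟩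

end Signed

end MARG

theorem proposition7 {Ω Θ : Type*} [MeasurableSpace Ω]
    [MetricSpace Θ] [PolishSpace Θ] [MeasurableSpace Θ] [BorelSpace Θ]
    (P : Measure Ω) [IsProbabilityMeasure P]
    (H : Measure Θ) (β c : ℕ → ℝ) (W : ℕ → Ω → Measure Θ) (hW : MARG.IsMARG P H β c W)
    (t : ℕ) (ht : 1 ≤ t) :
    -- mean of `W_t(g)`, for nonnegative `g`, as an identity in `[0, ∞]`
    (∀ g : Θ → ENNReal, Measurable g →
      ∫⁻ ω, ∫⁻ θ, g θ ∂(W t ω) ∂P =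
        ENNReal.ofReal (MARG.lagScale β c t 1) * ∫⁻ θ, g θ ∂H +
          ENNReal.ofReal (MARG.lagRho β c t 1) * ∫⁻ θ, g θ ∂(MARG.meanMeasure P (W 1))) ∧
    -- mean of `W_t(g)`, for integrable `g`
    (∀ g : Θ → ℝ, Measurable g →
      Integrable g H → Integrable g (MARG.meanMeasure P (W 1)) →
      (∀ᵐ ω ∂P, Integrable g (W t ω)) ∧ Integrable (MARG.integ (W t) g) P ∧
      ∫ ω, MARG.integ (W t) g ω ∂P =
        MARG.lagScale β c t 1 * ∫ θ, g θ ∂H +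
          MARG.lagRho β c t 1 * ∫ θ, g θ ∂(MARG.meanMeasure P (W 1))) ∧
    -- covariances
    (∀ g₁ g₂ : Θ → ℝ, Measurable g₁ → Measurable g₂ →
      Integrable g₁ H → Integrable g₂ H →
      Integrable g₁ (MARG.meanMeasure P (W 1)) → Integrable g₂ (MARG.meanMeasure P (W 1)) →
      -- existence of the product moments
      (Integrable (fun θ => g₁ θ * g₂ θ) H →
        Integrable (fun θ => g₁ θ * g₂ θ) (MARG.meanMeasure P (W 1)) →
        Integrable (fun ω => MARG.integ (W 1) (fun θ => |g₁ θ|) ω *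
          MARG.integ (W 1) (fun θ => |g₂ θ|) ω) P →
        ∀ h : ℕ, Integrable (fun ω => MARG.integ (W t) g₁ ω * MARG.integ (W (t + h)) g₂ ω) P) ∧
      -- covariance at lag zero
      (Integrable (fun θ => g₁ θ * g₂ θ) H →
        Integrable (fun θ => g₁ θ * g₂ θ) (MARG.meanMeasure P (W 1)) →
        Integrable (fun ω => MARG.integ (W 1) g₁ ω * MARG.integ (W 1) g₂ ω) P →
        Integrable (fun ω => MARG.integ (W t) g₁ ω * MARG.integ (W t) g₂ ω) P →
        covariance (MARG.integ (W t) g₁) (MARG.integ (W t) g₂) P =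
          MARG.lagScale β c t 1 ^ 2 * ∫ θ, g₁ θ * g₂ θ ∂H +
            2 * MARG.lagRho β c t 1 * MARG.lagScale β c t 1 *
              ∫ θ, g₁ θ * g₂ θ ∂(MARG.meanMeasure P (W 1)) +
            MARG.lagRho β c t 1 ^ 2 *
              covariance (MARG.integ (W 1) g₁) (MARG.integ (W 1) g₂) P) ∧
      -- covariance at lag `h`
      (∀ h : ℕ,
        Integrable (fun ω => MARG.integ (W t) g₁ ω * MARG.integ (W t) g₂ ω) P →
        Integrable (fun ω => MARG.integ (W t) g₁ ω * MARG.integ (W (t + h)) g₂ ω) P →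
        covariance (MARG.integ (W t) g₁) (MARG.integ (W (t + h)) g₂) P =
          MARG.lagRho β c (t + h) t *
            covariance (MARG.integ (W t) g₁) (MARG.integ (W t) g₂) P)) := by
  refine ⟨fun g hg => hW.lintegral_lintegral ht hg, fun g hg hH hM =>
    ⟨hW.ae_integrable ht hg hH hM, hW.integrable_integ ht hg hH hM,
      hW.integral_integ ht hg hH hM⟩, fun g₁ g₂ hg₁ hg₂ hH₁ hH₂ hM₁ hM₂ => ⟨?_, ?_, ?_⟩⟩
  · exact fun hH hM h₁ h => hW.integrable_integ_mul_add ht h hg₁ hg₂ hH₁ hH₂ hH hM₁ hM₂ hM h₁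
  · exact fun hH hM h₁ h_t => hW.covariance_integ ht hg₁ hg₂ hH₁ hH₂ hH hM₁ hM₂ hM h₁ h_t
  · exact fun h h₀ h₁ => hW.covariance_integ_add ht h hg₁ hg₂ hH₁ hH₂ hM₁ hM₂ h₀ h₁
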